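/- Let $\mathbb X$ be a Polish space with its Borel $\sigma$-algebra, $\alpha$ a finite, diffuse, non-zero measure on $\mathbb X$, $\nu^*$ a measure on $(0,\infty)$ with $\int\min\{1,z\}\,\nu^*(dz)<\infty$, and $f$ a probability density on $(0,\infty)$; put $h(s_1,\dots,s_d)=\prod_{j=1}^d f(s_j)$. Let $\tilde\eta=\sum_{i\ge1}J_i\delta_{\tilde x_i}$ be a completely random measure with Lévy intensity $\nu^*(dz)\,\alpha(dx)$, that is, let the atoms $(J_i,\tilde x_i)$ with $J_i>0$ form a Poisson process on $(0,\infty)\times\mathbb X$ with this intensity. Independently of it let the score vectors $(m_{1,i},\dots,m_{d,i})$, $i\ge1$, be i.i.d. with density $h$, and let $$\tilde\mu_j=\sum_{i\ge1}m_{j,i}J_i\delta_{\tilde x_i},\qquad \tilde p_j=\tilde\mu_j/\tilde\mu_j(\mathbb X),\qquad j=1,\dots,d$$ be the corresponding compound random measures (CoRMs) and normalized CoRMs. Assume $$\int_0^\infty z^{-d}\int_{(0,\infty)^d}\min\{1,\|s\|\}\,h(s_1/z,\dots,s_d/z)\,ds\,\nu^*(dz)<\infty,\qquad \int_0^\infty\int_0^\infty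 z^{-1}f(s/z)\,ds\,\nu^*(dz)=\infty .$$ Let $(X_{i,j})_{i\ge1,\,1\le j\le d}$ be an array of $\mathbb X$-valued random variables which, conditionally on $(\tilde p_1,\dots,\tilde p_d)$, are independent with $X_{i,j}\sim\tilde p_j$. Let $n_{\ell,j}\ge0$ ($1\le\ell\le k$, $1\le j\le d$) be integers with $\sum_j n_{\ell,j}\ge1$ for every $\ell$ and $n_j:=\sum_\ell n_{\ell,j}\ge1$ for every $j$. The partially exchangeable partition probability function (pEPPF) is $$\Pi_k^{(n)}(\boldsymbol n_1,\dots,\boldsymbol n_d)=\mathbb E\Big[\int_{\mathbb X^k}\prod_{j=1}^d\prod_{\ell=1}^k\tilde p_j^{\,n_{\ell,j}}(dx_\ell)\Big]=\mathbb E\Big[\sum_{x_1,\dots,x_k\ \text{distinct}}\ \prod_{j=1}^d\prod_{\ell=1}^k\tilde p_j(\{x_\ell\})^{n_{\ell,j}}\Big],$$ where the integral is read as the sum over ordered $k$-tuples of distinct points on the right. Then $$\Pi_k^{(n)}(\boldsymbol n_1,\dots,\boldsymbol n_d)=\int_{(0,\infty)^d}\prod_{j=1}^d\frac{u_j^{n_j-1}}{\Gamma(n_j)}\,\exp\Big\{-\alpha(\mathbb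 X)\int_0^\infty\Big[1-\prod_{j=1}^d\int_0^\infty e^{-u_jms}f(m)\,dm\Big]\nu^*(ds)\Big\}\ \alpha(\mathbb X)^k\prod_{\ell=1}^k\int_0^\infty\prod_{j=1}^d\Big(\int_0^\infty e^{-u_jms}(ms)^{n_{\ell,j}}f(m)\,dm\Big)\nu^*(ds)\ du_1\cdots du_d .$$ Moreover, for every partition of the index set $\{(i,j):1\le j\le d,\ 1\le i\le n_j\}$ into $k$ blocks whose $\ell$-th block contains exactly $n_{\ell,j}$ indices of the $j$-th group, the probability that the partition of the sample $\{X_{i,j}: 1\le j\le d,\ 1\le i\le n_j\}$ induced by its ties is this partition equals the same quantity. -/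

import Mathlib

open MeasureTheory ProbabilityTheory Set
open scoped ENNReal NNReal

noncomputable section

namespace CoRM

variable {Ω E 𝕏 : Type*} [MeasurableSpace Ω] [MeasurableSpace E] [MeasurableSpace 𝕏]

/-- The open positive orthant `(0, ∞)^d`. -/
def orthant (d : ℕ) : Set (Fin d → ℝ) := {u | ∀ j, 0 < u j}

/-- `N` is a Poisson random measure on `E` with intensity (mean measure) `ν`: the counts of
measurable sets of finite intensity are Poisson distributed, those of sets of infinite intensity
are almost surely infinite, and the counts of disjoint sets are independent. -/
structure IsPoissonRandomMeasure (P : Measure Ω) (N : Ω → Measure E) (ν : Measure E) : Prop where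
  measurable : Measurable N
  law_count : ∀ C : Set E, MeasurableSet C → ν C ≠ ∞ →
    HasLaw (fun ω => N ω C)
      ((poissonMeasure (ν C).toNNReal).map (fun n : ℕ => (n : ℝ≥0∞))) P
  count_top : ∀ C : Set E, MeasurableSet C → ν C = ∞ → ∀ᵐ ω ∂P, N ω C = ∞
  indep : ∀ (r : ℕ) (C : Fin r → Set E), (∀ i, MeasurableSet (C i)) →
    Pairwise (fun i j => Disjoint (C i) (C j)) → iIndepFun (fun i ω => N ω (C i)) P

/-- The point process on `(0, ∞) × 𝕏` formed by the (height, location) pairs of the atoms of the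
random measure `∑ i, J i • δ_{x i}`; terms of height zero are not atoms and are discarded. -/
def atomProcess (J : ℕ → Ω → ℝ) (x : ℕ → Ω → 𝕏) (ω : Ω) : Measure (ℝ × 𝕏) :=
  (Measure.sum fun i => Measure.dirac (J i ω, x i ω)).restrict (Ioi 0 ×ˢ univ)

/-- The random heights `J i ≥ 0` and random locations `x i` represent a homogeneous completely
random measure `η = ∑ i, J i • δ_{x i}`, without fixed atoms and without drift, with Lévy intensity
`ν(dz) α(dx)` on `(0, ∞) × 𝕏`: the atoms form a Poisson process with that intensity, and
`ν` satisfies `∫ min(1, z) ν(dz) < ∞`. Only the values of `ν` on `(0, ∞)` matter. -/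
structure IsHomogeneousCRM (P : Measure Ω) (ν : Measure ℝ) (α : Measure 𝕏)
    (J : ℕ → Ω → ℝ) (x : ℕ → Ω → 𝕏) : Prop where
  measurable_height : ∀ i, Measurable (J i)
  measurable_location : ∀ i, Measurable (x i)
  height_nonneg : ∀ i, ∀ᵐ ω ∂P, 0 ≤ J i ω
  levy : ∫⁻ z in Ioi 0, min 1 (ENNReal.ofReal z) ∂ν < ∞
  poisson : IsPoissonRandomMeasure P (atomProcess J x) ((ν.restrict (Ioi 0)).prod α)

/-- `f` is a probability density on `(0, ∞)` (its values outside are irrelevant). -/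
structure IsDensity (f : ℝ → ℝ≥0) : Prop where
  measurable : Measurable f
  lintegral_eq_one : ∫⁻ m in Ioi 0, (f m : ℝ≥0∞) = 1

/-- `h` is a probability density on `(0, ∞)^d` (its values outside are irrelevant). -/
structure IsScoreDensity {d : ℕ} (h : (Fin d → ℝ) → ℝ≥0) : Prop where
  measurable : Measurable h
  lintegral_eq_one : ∫⁻ s in orthant d, (h s : ℝ≥0∞) = 1

/-- The data `(J, x, m)` of a vector of compound random measures with directing Lévy measure `ν`,
base measure `α` and score density `h`: a driving completely random measure `∑ i, J i • δ_{x i}`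
with Lévy intensity `ν(dz) α(dx)` and, independently of it, i.i.d. score vectors
`m i = (m_{1,i}, …, m_{d,i})` with density `h`. -/
structure IsCoRM {d : ℕ} (P : Measure Ω) (ν : Measure ℝ) (α : Measure 𝕏) (h : (Fin d → ℝ) → ℝ≥0)
    (J : ℕ → Ω → ℝ) (x : ℕ → Ω → 𝕏) (m : ℕ → Ω → Fin d → ℝ) : Prop where
  driving : IsHomogeneousCRM P ν α J x
  score_density : IsScoreDensity h
  measurable_score : ∀ i, Measurable (m i)
  law_score : ∀ i, HasLaw (m i)
    ((volume.restrict (orthant d)).withDensity (fun s => (h s : ℝ≥0∞))) P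
  iIndep_score : iIndepFun m P
  indep_driving : IndepFun (fun ω i => m i ω) (fun ω i => (J i ω, x i ω)) P

/-- The `j`-th compound random measure `μ_j = ∑ i, m_{j,i} J_i δ_{x_i}`. -/
def corm {d : ℕ} (J : ℕ → Ω → ℝ) (x : ℕ → Ω → 𝕏) (m : ℕ → Ω → Fin d → ℝ) (j : Fin d) (ω : Ω) :
    Measure 𝕏 :=
  Measure.sum fun i => ENNReal.ofReal (m i ω j * J i ω) • Measure.dirac (x i ω)

/-- The normalized compound random measure `p_j = μ_j / μ_j(𝕏)`. -/
def normalizedCorm {d : ℕ} (J : ℕ → Ω → ℝ) (x : ℕ → Ω → 𝕏) (m : ℕ → Ω → Fin d → ℝ)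
    (j : Fin d) (ω : Ω) : Measure 𝕏 :=
  (corm J x m j ω univ)⁻¹ • corm J x m j ω

/-- Regularity condition on the directing Lévy measure:
`∫ z^{-d} ∫ min(1, ‖s‖) h(s / z) ds ν(dz) < ∞`, with the Euclidean norm. -/
def RegularityCondition {d : ℕ} (ν : Measure ℝ) (h : (Fin d → ℝ) → ℝ≥0) : Prop :=
  ∫⁻ z in Ioi 0, ENNReal.ofReal (z⁻¹ ^ d) *
    (∫⁻ s in orthant d, min 1 (ENNReal.ofReal ‖WithLp.toLp 2 s‖) * (h (fun j => s j / z) : ℝ≥0∞))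
      ∂ν < ∞

/-- The score density factorizes into identical marginal densities `f`. -/
def Factorizes {d : ℕ} (h : (Fin d → ℝ) → ℝ≥0) (f : ℝ → ℝ≥0) : Prop :=
  ∀ s ∈ orthant d, h s = ∏ j, f (s j)

/-- The marginal Lévy measures are infinite: `∫ ∫ z^{-1} f(s / z) ds ν(dz) = ∞`. -/
def InfiniteActivity (ν : Measure ℝ) (f : ℝ → ℝ≥0) : Prop :=
  ∫⁻ z in Ioi 0, (∫⁻ s in Ioi 0, ENNReal.ofReal z⁻¹ * (f (s / z) : ℝ≥0∞)) ∂ν = ∞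

/-- The σ-algebra generated by the random measures `p_1, …, p_d`. -/
@[reducible] def sigmaOf {d : ℕ} (p : Fin d → Ω → Measure 𝕏) : MeasurableSpace Ω :=
  ⨆ j, MeasurableSpace.comap (p j) inferInstance

/-- The array `X j i` (`j` the group, `i` the position in the group, counted from `0`) follows
the partially exchangeable model directed by `p`: conditionally on `(p_1, …, p_d)` its entries are
independent, and those of the `j`-th group have distribution `p_j`. -/
structure IsPartiallyExchangeableSample {d : ℕ} (P : Measure Ω) (p : Fin d → Ω → Measure 𝕏)
    (X : Fin d → ℕ → Ω → 𝕏) : Prop where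
  measurable : ∀ j i, Measurable (X j i)
  cond_law : ∀ (S : Finset (Fin d × ℕ)) (A : Fin d × ℕ → Set 𝕏), (∀ a, MeasurableSet (A a)) →
    ∀ G : Set Ω, MeasurableSet[sigmaOf p] G →
      P (G ∩ ⋂ a ∈ S, X a.1 a.2 ⁻¹' A a) = ∫⁻ ω in G, ∏ a ∈ S, p a.1 ω (A a) ∂P

/-- The partially exchangeable partition probability function
`E[∫ ∏_j ∏_ℓ p_j^{n_{ℓ,j}}(dx_ℓ)]` of discrete random probability measures `p_1, …, p_d`. The
integral is over distinct `x_1, …, x_k`; for discrete `p_j` the measure `∏_j p_j^{n_j}(dx)` puts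
mass `∏_j p_j({x})^{n_j}` on every point `x`, so that the integral is the sum below. -/
def pEPPF {d k : ℕ} (P : Measure Ω) (p : Fin d → Ω → Measure 𝕏) (n : Fin k → Fin d → ℕ) : ℝ≥0∞ :=
  ∫⁻ ω, ∑' x : Fin k ↪ 𝕏, ∏ j, ∏ ℓ, p j ω {x ℓ} ^ n ℓ j ∂P

/-- The event that the first `N j` entries of the groups `j = 1, …, d` are partitioned by their ties
into the blocks of constancy of `π`. -/
def partitionEvent {d k : ℕ} (X : Fin d → ℕ → Ω → 𝕏) (N : Fin d → ℕ)
    (π : (Σ j : Fin d, Fin (N j)) → Fin k) : Set Ω :=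
  {ω | ∀ a b : Σ j : Fin d, Fin (N j), X a.1 a.2 ω = X b.1 b.2 ω ↔ π a = π b}

/-- `∫_0^∞ e^{-u m s} (m s)^n f(m) dm`. -/
def scoreMoment (f : ℝ → ℝ≥0) (u s : ℝ) (n : ℕ) : ℝ≥0∞ :=
  ∫⁻ m in Ioi 0, ENNReal.ofReal (Real.exp (-(u * m * s)) * (m * s) ^ n) * (f m : ℝ≥0∞)

/-- The Laplace exponent `∫_0^∞ [1 - ∏_j ∫_0^∞ e^{-u_j m s} f(m) dm] ν(ds)`. -/
def laplaceExponent {d : ℕ} (ν : Measure ℝ) (f : ℝ → ℝ≥0) (u : Fin d → ℝ) : ℝ≥0∞ :=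
  ∫⁻ s in Ioi 0, (1 - ∏ j, ∫⁻ m in Ioi 0,
    ENNReal.ofReal (Real.exp (-(u j * m * s))) * (f m : ℝ≥0∞)) ∂ν

end CoRM

end

/-! Write `T_j` for the total mass of the `j`-th compound random measure. Almost surely the
locations of the atoms of positive height are distinct, because `α` is diffuse. The sum over
distinct points defining the pEPPF is therefore a sum over distinct atoms of products of `(m_{j,i}
J_i)^{n_{ℓ,j}}`, divided by `∏_j T_j^{N_j}`. The normalization is removed by the Gamma integral
`T^{-N} = Γ(N)⁻¹ ∫ u^{N-1} e^{-uT} du` (`lintegral_gamma_expNeg`). Tonelli then leaves, for each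
fixed `u`, the mean of a sum over distinct atoms weighted by `exp(-∑_j u_j T_j)`.

That mean is computed by `lintegral_marked_poisson`, a Mecke formula combined with the Laplace
functional of a marked Poisson process. It factors into one integral per block and one exponential.
Since the score density is a product, each inner integral over the scores splits into the factors
`scoreMoment` (`lintegral_scoreWeight`).

The Mecke formula is derived from the defining properties of a Poisson random measure. For
indicators of disjoint sets, the number of distinct tuples is a product of falling factorials of
independent Poisson counts, whose weighted moments are explicit. Linearity and two limit passages
give `lintegral_poisson`. Independent marks are averaged out beforehand: `g` and `q` are replaced by
functions `a`, `v` of the points alone, chosen so that `e^{-v}` and `a e^{-v}` are the conditional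
means of `e^{-q}` and `g e^{-q}`.

For the partition probability, the joint law of the sample is expanded over the atoms from which the
observations are drawn (`map_sample_eq_sum`). The tie event keeps exactly the assignments that are
constant on blocks and distinct across blocks, which is the same sum over distinct atoms. The
existence of the sample also forces `0 < T_j < ∞` almost surely (`ae_totalMass_ne`). -/

noncomputable section

open Filter Topology

/-! ### The exponential `e^{-x}` on `[0, ∞]`. -/

/-- The function `x ↦ exp (-x)` on `[0, ∞]`. -/
def expNeg (x : ℝ≥0∞) : ℝ≥0∞ := EReal.exp (-(x : EReal))

theorem expNeg_zero : expNeg 0 = 1 := by simp [expNeg]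

theorem expNeg_add (a b : ℝ≥0∞) : expNeg (a + b) = expNeg a * expNeg b := by
  unfold expNeg
  rw [EReal.coe_ennreal_add, EReal.neg_add (by simp) (by simp), sub_eq_add_neg, EReal.exp_add]

theorem expNeg_ofReal {r : ℝ} (hr : 0 ≤ r) :
    expNeg (ENNReal.ofReal r) = ENNReal.ofReal (Real.exp (-r)) := by
  unfold expNeg
  rw [EReal.coe_ennreal_ofReal, max_eq_left hr, ← EReal.coe_neg, EReal.exp_coe]

theorem continuous_expNeg : Continuous expNeg :=
  ENNReal.continuous_exp.comp (continuous_neg.comp continuous_coe_ennreal_ereal)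

theorem measurable_expNeg : Measurable expNeg := continuous_expNeg.measurable

@[fun_prop]
theorem Measurable.expNeg {α : Type*} [MeasurableSpace α] {f : α → ℝ≥0∞} (hf : Measurable f) :
    Measurable fun a => expNeg (f a) := measurable_expNeg.comp hf

theorem expNeg_antitone : Antitone expNeg := fun _ _ h =>
  EReal.exp_monotone (EReal.neg_le_neg_iff.2 (EReal.coe_ennreal_le_coe_ennreal_iff.2 h))

theorem expNeg_le_one (a : ℝ≥0∞) : expNeg a ≤ 1 :=
  expNeg_zero ▸ expNeg_antitone zero_le

theorem expNeg_ne_top (a : ℝ≥0∞) : expNeg a ≠ ∞ := ne_top_of_le_ne_top (by simp) (expNeg_le_one a)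

theorem expNeg_ne_zero {a : ℝ≥0∞} (ha : a ≠ ∞) : expNeg a ≠ 0 := by
  simpa [expNeg] using ha

theorem expNeg_sum {ι : Type*} (s : Finset ι) (f : ι → ℝ≥0∞) :
    expNeg (∑ i ∈ s, f i) = ∏ i ∈ s, expNeg (f i) := by
  classical
  induction s using Finset.induction_on with
  | empty => simp [expNeg_zero]
  | insert a s ha ih => rw [Finset.sum_insert ha, Finset.prod_insert ha, expNeg_add, ih]

theorem tendsto_prod_expNeg (f : ℕ → ℝ≥0∞) :
    Tendsto (fun M => ∏ i ∈ Finset.range M, expNeg (f i)) atTop (𝓝 (expNeg (∑' i, f i))) := by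
  simp_rw [← expNeg_sum]
  exact (continuous_expNeg.tendsto _).comp (ENNReal.tendsto_nat_tsum f)

theorem expNeg_natCast_mul (n : ℕ) (v : ℝ≥0∞) : expNeg (n * v) = expNeg v ^ n := by
  have := expNeg_sum (Finset.range n) (fun _ => v)
  simpa using this

/-- Every `t ∈ [0, 1]` is of the form `exp (-v)`. -/
theorem exists_measurable_expNeg_eq {α : Type*} [MeasurableSpace α] {φ : α → ℝ≥0∞}
    (hφ : Measurable φ) (h1 : ∀ a, φ a ≤ 1) :
    ∃ v : α → ℝ≥0∞, Measurable v ∧ ∀ a, expNeg (v a) = φ a := by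
  refine ⟨fun a => (-ENNReal.log (φ a)).toENNReal, by fun_prop, fun a => ?_⟩
  have : 0 ≤ -ENNReal.log (φ a) := by
    have h := ENNReal.log_monotone (h1 a)
    rw [ENNReal.log_one] at h
    exact EReal.neg_nonneg.2 h
  rw [expNeg, EReal.coe_toENNReal this, neg_neg, ENNReal.exp_log]

/-! ### Factorial moments of Poisson laws and counting of distinct tuples. -/

/-- The factorial moment of a Poisson law, weighted by `t ^ n`. -/
theorem tsum_poisson_descFactorial (l : ℝ≥0) (t : ℝ≥0∞) (ht : t ≤ 1) (K : ℕ) :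
    ∑' n : ℕ, ENNReal.ofReal (Real.exp (-(l : ℝ)) * (l : ℝ) ^ n / n.factorial) * ((n.descFactorial K : ℝ≥0∞) * t ^ n)
      = (l * t) ^ K * expNeg (l * (1 - t)) := by
  lift t to ℝ≥0 using ne_top_of_le_ne_top (by simp) ht
  have ht' : (t : ℝ) ≤ 1 := by exact_mod_cast ht
  have hr : expNeg (l * (1 - t)) = ENNReal.ofReal (Real.exp (-((l : ℝ) * (1 - t)))) := by
    rw [← expNeg_ofReal (mul_nonneg l.coe_nonneg (by linarith : (0 : ℝ) ≤ 1 - t)), ENNReal.ofReal_mul (by positivity)]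
    simp [ENNReal.ofReal_sub]
  rw [hr]
  -- The terms with `n < K` vanish; after a shift by `K` an exponential series in `l * t` remains.
  have hinj : Function.Injective (fun n : ℕ => n + K) := add_left_injective K
  rw [← hinj.tsum_eq]
  · have key : ∀ n : ℕ, ENNReal.ofReal (Real.exp (-(l : ℝ)) * (l : ℝ) ^ (n + K) / (n + K).factorial) *
        (((n + K).descFactorial K : ℝ≥0∞) * t ^ (n + K)) =
        ((l * t) ^ K * ENNReal.ofReal (Real.exp (-(l : ℝ)))) * ENNReal.ofReal (((l : ℝ) * t) ^ n / n.factorial) := by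
      intro n
      have h1 : (((n + K).descFactorial K : ℝ≥0∞) * t ^ (n + K)) =
          ENNReal.ofReal (((n + K).descFactorial K : ℝ) * (t : ℝ) ^ (n + K)) := by
        rw [ENNReal.ofReal_mul (by positivity), ENNReal.ofReal_natCast, ENNReal.ofReal_pow t.coe_nonneg,
          ENNReal.ofReal_coe_nnreal]
      have h2 : ((l : ℝ≥0∞) * t) ^ K = ENNReal.ofReal (((l : ℝ) * t) ^ K) := by
        rw [ENNReal.ofReal_pow (by positivity), ENNReal.ofReal_mul (by positivity),
          ENNReal.ofReal_coe_nnreal, ENNReal.ofReal_coe_nnreal]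
      rw [h1, h2, ← ENNReal.ofReal_mul (by positivity), ← ENNReal.ofReal_mul (by positivity),
        ← ENNReal.ofReal_mul (by positivity)]
      congr 1
      have h3 : ((n + K).factorial : ℝ) = n.factorial * (n + K).descFactorial K := by
        have := Nat.factorial_mul_descFactorial (n := n + K) (k := K) (by omega)
        rw [Nat.add_sub_cancel] at this
        exact_mod_cast this.symm
      have h4 : ((n + K).descFactorial K : ℝ) ≠ 0 := by
        have : 0 < (n + K).descFactorial K := Nat.descFactorial_pos.2 (by omega)
        positivity
      have h5 : (n.factorial : ℝ) ≠ 0 := by positivity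
      rw [h3]
      field_simp
      ring
    simp_rw [key]
    rw [ENNReal.tsum_mul_left, mul_assoc]
    congr 1
    have hs := NormedSpace.expSeries_div_hasSum_exp ((l * t : ℝ))
    rw [← Real.exp_eq_exp_ℝ] at hs
    rw [← ENNReal.ofReal_tsum_of_nonneg (fun n => by positivity) hs.summable, hs.tsum_eq,
      ← ENNReal.ofReal_mul (by positivity), ← Real.exp_add]
    congr 2
    ring
  · intro n hn
    by_contra h
    apply hn
    have : n < K := by
      by_contra h'
      exact h ⟨n - K, by simp; omega⟩
    simp [Nat.descFactorial_eq_zero_iff_lt.2 this]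

theorem lintegral_poissonMeasure (l : ℝ≥0) (g : ℕ → ℝ≥0∞) :
    ∫⁻ n, g n ∂(poissonMeasure l)
      = ∑' n : ℕ, ENNReal.ofReal (Real.exp (-(l : ℝ)) * (l : ℝ) ^ n / n.factorial) * g n := by
  simp [poissonMeasure, lintegral_sum_measure]

/-- Tonelli's theorem for products of functions of one coordinate. -/
theorem lintegral_pi_fin_prod {n : ℕ} {E : Type*} [MeasurableSpace E] {μ : Fin n → Measure E}
    [∀ i, SigmaFinite (μ i)] {f : Fin n → E → ℝ≥0∞} (hf : ∀ i, Measurable (f i)) :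
    ∫⁻ x : Fin n → E, ∏ i, f i (x i) ∂(Measure.pi μ) = ∏ i, ∫⁻ x, f i x ∂(μ i) := by
  induction n with
  | zero => simp
  | succ n n_ih =>
    have hr : Measurable fun x : Fin n → E => ∏ i : Fin n, f i.succ (x i) :=
      Finset.measurable_prod _ fun i _ => (hf i.succ).comp (measurable_pi_apply i)
    rw [← ((measurePreserving_piFinSuccAbove μ 0).symm).lintegral_comp_emb
      (MeasurableEquiv.measurableEmbedding _), Fin.prod_univ_succ, ← n_ih fun i => hf i.succ]
    refine Eq.trans ?_ (lintegral_prod_mul (hf 0).aemeasurable hr.aemeasurable)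
    refine lintegral_congr fun a => ?_
    rw [Fin.prod_univ_succ]
    rfl

/-- Monotone convergence for the counting measure; the discrete σ-algebra makes every function
measurable. -/
theorem tendsto_tsum_of_monotone {ι : Type*} {f : ℕ → ι → ℝ≥0∞} {g : ι → ℝ≥0∞}
    (hf : ∀ i, Monotone fun n => f n i) (hg : ∀ i, Tendsto (fun n => f n i) atTop (𝓝 (g i))) :
    Tendsto (fun n => ∑' i, f n i) atTop (𝓝 (∑' i, g i)) := by
  let _ : MeasurableSpace ι := ⊤
  have : MeasurableSingletonClass ι := ⟨fun _ => trivial⟩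
  have h := lintegral_tendsto_of_tendsto_of_monotone (μ := Measure.count)
    (fun n => (measurable_from_top (f := f n)).aemeasurable) (ae_of_all _ hf) (ae_of_all _ hg)
  simpa only [lintegral_count] using h

instance countable_fin_embedding (k : ℕ) : Countable (Fin k ↪ ℕ) :=
  DFunLike.coe_injective.countable

/-- The number of ways of choosing distinct points of a configuration in prescribed disjoint sets
is a product of falling factorials. -/
theorem tsum_embedding_prod_indicator {E ι : Type*} [Fintype ι] [DecidableEq ι]
    (C : ι → Set E) (hC : Pairwise fun i j => Disjoint (C i) (C j)) (z : ℕ → E) (k : ℕ)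
    (c : Fin k → ι) :
    ∑' e : Fin k ↪ ℕ, ∏ l, (C (c l)).indicator (1 : E → ℝ≥0∞) (z (e l)) =
      ∏ r, ∏ j ∈ Finset.range (Finset.univ.filter fun l => c l = r).card,
        ((∑' i, (C r).indicator (1 : E → ℝ≥0∞) (z i)) - (j : ℝ≥0∞)) := by
  induction k with
  | zero => simp
  | succ k ih =>
    let cnt : ι → ℝ≥0∞ := fun r => ∑' i, (C r).indicator (1 : E → ℝ≥0∞) (z i)
    have hrhs : ∀ r, ∏ j ∈ Finset.range (Finset.univ.filter fun l => c l = r).card,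
          (cnt r - (j : ℝ≥0∞)) =
        (∏ j ∈ Finset.range (Finset.univ.filter fun l : Fin k => c l.succ = r).card,
          (cnt r - (j : ℝ≥0∞))) *
        (if c 0 = r then
          cnt r - ((Finset.univ.filter fun l : Fin k => c l.succ = r).card : ℝ≥0∞) else 1) := by
      intro r
      rw [Fin.card_filter_univ_succ]
      split_ifs with h
      · rw [Finset.prod_range_succ]
      · rw [mul_one]
    change _ = ∏ r, ∏ j ∈ Finset.range (Finset.univ.filter fun l => c l = r).card,
      (cnt r - (j : ℝ≥0∞))
    simp_rw [hrhs, Finset.prod_mul_distrib, Finset.prod_ite_eq, Finset.mem_univ, if_true]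
    -- An embedding of `Fin (k + 1)` is an embedding `e` of the last `k` positions together with an
    -- index outside `range e`, so the first point is chosen last.
    rw [← ih (fun l => c l.succ), ← (Equiv.embeddingFinSucc k ℕ).symm.tsum_eq, ENNReal.tsum_sigma',
      ← ENNReal.tsum_mul_right]
    refine tsum_congr fun e => ?_
    simp_rw [Fin.prod_univ_succ, Equiv.coe_embeddingFinSucc_symm, Fin.cons_zero, Fin.cons_succ]
    rw [ENNReal.tsum_mul_right, mul_comm]
    -- If all points already chosen lie in their sets, disjointness shows that exactly those with
    -- label `c 0` lie in `C (c 0)`, and they are lost for the last choice. Otherwise both sides are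
    -- zero.
    by_cases h : ∀ l : Fin k, z (e l) ∈ C (c l.succ)
    · congr 1
      refine ENNReal.eq_sub_of_add_eq (by simp) ?_
      have h1 : ((Finset.univ.filter fun l : Fin k => c l.succ = c 0).card : ℝ≥0∞) =
          ∑' i : Set.range e, (C (c 0)).indicator (1 : E → ℝ≥0∞) (z i) := by
        rw [← (Equiv.ofInjective e e.injective).tsum_eq, tsum_fintype, Finset.card_filter,
          Nat.cast_sum]
        refine Finset.sum_congr rfl fun l _ => ?_
        rw [Equiv.ofInjective_apply]
        by_cases hl : c l.succ = c 0
        · have hm : z (e l) ∈ C (c 0) := hl ▸ h l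
          simp [hl, hm]
        · have : z (e l) ∉ C (c 0) := fun h' => (hC hl).le_bot ⟨h l, h'⟩
          simp [hl, this]
      rw [h1, add_comm]
      exact ENNReal.summable.tsum_add_tsum_compl (s := Set.range e)
        (f := fun i => (C (c 0)).indicator (1 : E → ℝ≥0∞) (z i)) ENNReal.summable
    · push Not at h
      obtain ⟨l, hl⟩ := h
      rw [Finset.prod_eq_zero (Finset.mem_univ l) (by simp [hl])]
      simp

/-- On natural numbers the product of truncated differences is the descending factorial, so this is
`tsum_poisson_descFactorial` with `t = e^{-v}`. -/
theorem lintegral_factorial_poisson {Ω : Type*} [MeasurableSpace Ω] {P : Measure Ω}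
    {Y : Ω → ℝ≥0∞} {l : ℝ≥0}
    (hY : HasLaw Y ((poissonMeasure l).map (fun n : ℕ => (n : ℝ≥0∞))) P) (K : ℕ) (v : ℝ≥0∞) :
    ∫⁻ ω, (∏ j ∈ Finset.range K, (Y ω - (j : ℝ≥0∞))) * expNeg (Y ω * v) ∂P =
      (l * expNeg v) ^ K * expNeg (l * (1 - expNeg v)) := by
  have hm : Measurable fun y : ℝ≥0∞ =>
      (∏ j ∈ Finset.range K, (y - (j : ℝ≥0∞))) * expNeg (y * v) := by fun_prop
  rw [hY.lintegral_comp (f := fun y : ℝ≥0∞ =>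
      (∏ j ∈ Finset.range K, (y - (j : ℝ≥0∞))) * expNeg (y * v)) hm.aemeasurable,
    lintegral_map hm (by fun_prop), lintegral_poissonMeasure,
    ← tsum_poisson_descFactorial l _ (expNeg_le_one v) K]
  refine tsum_congr fun n => ?_
  rw [expNeg_natCast_mul, Nat.descFactorial_eq_prod_range, Nat.cast_prod]
  simp

/-! ### The Mecke formula for functions of finite range. -/

section Poisson

variable {Ω E : Type*} [MeasurableSpace Ω] [MeasurableSpace E] {P : Measure Ω} {μ : Measure E} {S : Set E} {z : ℕ → Ω → E}

/-- The number of distinct tuples and the exponential are both products over `r` of functions of the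
count in `C r`. These counts are independent and Poisson, so the expectation factors into weighted
factorial moments; grouping the labels `c` by fibres gives the product over `l`. -/
theorem lintegral_prod_indicator_poisson
    (hN : CoRM.IsPoissonRandomMeasure P
      (fun ω => (Measure.sum fun i => Measure.dirac (z i ω)).restrict S) μ)
    {ι : Type*} [Fintype ι] [DecidableEq ι] (C : ι → Set E) (hCm : ∀ i, MeasurableSet (C i))
    (hC : Pairwise fun i j => Disjoint (C i) (C j)) (hCS : ∀ i, C i ⊆ S) (hμ : ∀ i, μ (C i) ≠ ∞)
    (V : ι → ℝ≥0∞) {k : ℕ} (c : Fin k → ι) :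
    ∫⁻ ω, (∑' e : Fin k ↪ ℕ, ∏ l, (C (c l)).indicator (1 : E → ℝ≥0∞) (z (e l) ω)) *
        expNeg (∑' i, ∑ r, V r * (C r).indicator (1 : E → ℝ≥0∞) (z i ω)) ∂P =
      (∏ l, (expNeg (V (c l)) * μ (C (c l)))) *
        expNeg (∑ r, (1 - expNeg (V r)) * μ (C r)) := by
  set N := fun ω => (Measure.sum fun i => Measure.dirac (z i ω)).restrict S with hNdef
  have hNC : ∀ r ω, N ω (C r) = ∑' i, (C r).indicator (1 : E → ℝ≥0∞) (z i ω) := by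
    intro r ω
    rw [hNdef]
    simp only
    rw [Measure.restrict_apply (hCm r), inter_eq_left.2 (hCS r), Measure.sum_apply _ (hCm r)]
    simp_rw [Measure.dirac_apply' _ (hCm r)]
  have hmeas : ∀ r, Measurable fun ω => N ω (C r) :=
    fun r => (Measure.measurable_coe (hCm r)).comp hN.measurable
  have hind : iIndepFun (fun r ω => N ω (C r)) P := by
    let eq := Fintype.equivFin ι
    have h := hN.indep (Fintype.card ι) (fun i => C (eq.symm i)) (fun i => hCm _)
      (fun i j hij => hC (fun h => hij (eq.symm.injective h)))
    have h' := h.precomp (g := eq) eq.injective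
    simpa using h'
  have hind' := hind.comp (fun r y =>
      (∏ j ∈ Finset.range (Finset.univ.filter fun l => c l = r).card, (y - (j : ℝ≥0∞))) *
        expNeg (y * V r)) (fun r => by fun_prop)
  have hL : ∀ ω, (∑' e : Fin k ↪ ℕ, ∏ l, (C (c l)).indicator (1 : E → ℝ≥0∞) (z (e l) ω)) *
        expNeg (∑' i, ∑ r, V r * (C r).indicator (1 : E → ℝ≥0∞) (z i ω)) =
      ∏ r, (∏ j ∈ Finset.range (Finset.univ.filter fun l => c l = r).card,
        (N ω (C r) - (j : ℝ≥0∞))) * expNeg (N ω (C r) * V r) := by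
    intro ω
    rw [tsum_embedding_prod_indicator C hC (fun i => z i ω), Summable.tsum_finsetSum fun _ _ => ENNReal.summable,
      expNeg_sum, ← Finset.prod_mul_distrib]
    refine Finset.prod_congr rfl fun r _ => ?_
    rw [ENNReal.tsum_mul_left, mul_comm (V r), hNC]
  simp_rw [hL]
  have := lintegral_prod_eq_prod_lintegral_of_indepFun Finset.univ _ hind' (fun r => by
    have := hmeas r
    exact (by fun_prop : Measurable fun y : ℝ≥0∞ =>
      (∏ j ∈ Finset.range (Finset.univ.filter fun l => c l = r).card, (y - (j : ℝ≥0∞))) *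
        expNeg (y * V r)).comp this)
  refine this.trans ?_
  have h2 : ∀ r, ∫⁻ ω, (∏ j ∈ Finset.range (Finset.univ.filter fun l => c l = r).card,
        (N ω (C r) - (j : ℝ≥0∞))) * expNeg (N ω (C r) * V r) ∂P =
      (expNeg (V r) * μ (C r)) ^ (Finset.univ.filter fun l => c l = r).card *
        expNeg ((1 - expNeg (V r)) * μ (C r)) := by
    intro r
    rw [lintegral_factorial_poisson (hN.law_count (C r) (hCm r) (hμ r)),
      ENNReal.coe_toNNReal (hμ r), mul_comm (μ _), mul_comm (μ _)]
  refine (Finset.prod_congr rfl fun r _ => h2 r).trans ?_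
  rw [Finset.prod_mul_distrib, expNeg_sum]
  congr 1
  simp_rw [← Finset.prod_const]
  rw [← Finset.prod_fiberwise' Finset.univ c (fun r => expNeg (V r) * μ (C r))]

/-- All the functions are packed into one map `s` so that they share a single partition into level
sets. Both sides are then multilinear in the indicators of these sets. -/
theorem lintegral_poisson_of_finite_range (hz : ∀ i, Measurable (z i))
    (hN : CoRM.IsPoissonRandomMeasure P
      (fun ω => (Measure.sum fun i => Measure.dirac (z i ω)).restrict S) μ)
    {k : ℕ} (s : E → (Fin k → ℝ≥0∞) × ℝ≥0∞) (hs : Measurable s) (hfin : (range s).Finite)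
    (hsS : ∀ y, s y ≠ 0 → y ∈ S) (hμ : μ {y | s y ≠ 0} ≠ ∞) :
    ∫⁻ ω, (∑' e : Fin k ↪ ℕ, ∏ l, (s (z (e l) ω)).1 l) * expNeg (∑' i, (s (z i ω)).2) ∂P =
      (∏ l, ∫⁻ y, (s y).1 l * expNeg (s y).2 ∂μ) * expNeg (∫⁻ y, 1 - expNeg (s y).2 ∂μ) := by
  classical
  -- The value `0` is left out: its level set may have infinite measure or leave `S`, and it
  -- contributes nothing to any `F` with `F 0 = 0`.
  let B : Finset ((Fin k → ℝ≥0∞) × ℝ≥0∞) := hfin.toFinset.erase 0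
  let C : B → Set E := fun b => s ⁻¹' {b.1}
  have hCm : ∀ b, MeasurableSet (C b) := fun b => hs (measurableSet_singleton _)
  have hC : Pairwise fun i j => Disjoint (C i) (C j) := by
    intro i j hij
    refine Disjoint.preimage s ?_
    rw [disjoint_singleton]
    exact fun h => hij (Subtype.ext h)
  have hne : ∀ (b : B) (y), y ∈ C b → s y ≠ 0 := by
    intro b y hy
    have : s y = b.1 := hy
    rw [this]
    exact Finset.ne_of_mem_erase b.2
  have hCS : ∀ b, C b ⊆ S := fun b y hy => hsS y (hne b y hy)
  have hCμ : ∀ b, μ (C b) ≠ ∞ := fun b => ne_top_of_le_ne_top hμ (measure_mono (hne b))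
  have hrep : ∀ (F : (Fin k → ℝ≥0∞) × ℝ≥0∞ → ℝ≥0∞), F 0 = 0 → ∀ y,
      F (s y) = ∑ b : B, F b * (C b).indicator (1 : E → ℝ≥0∞) y := by
    intro F hF y
    by_cases h0 : s y = 0
    · rw [h0, hF, eq_comm]
      refine Finset.sum_eq_zero fun b _ => ?_
      have : y ∉ C b := fun h => hne b y h h0
      simp [this]
    · have hb : s y ∈ B := Finset.mem_erase.2 ⟨h0, hfin.mem_toFinset.2 ⟨y, rfl⟩⟩
      rw [Finset.sum_eq_single ⟨s y, hb⟩]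
      · simp [C]
      · intro b _ hbne
        have : y ∉ C b := fun h => hbne (Subtype.ext (Eq.symm h))
        simp [this]
      · simp
  have hint : ∀ (F : (Fin k → ℝ≥0∞) × ℝ≥0∞ → ℝ≥0∞), F 0 = 0 →
      ∫⁻ y, F (s y) ∂μ = ∑ b : B, F b * μ (C b) := by
    intro F hF
    simp_rw [hrep F hF]
    rw [lintegral_finsetSum _ fun b _ => (measurable_one.indicator (hCm b)).const_mul _]
    refine Finset.sum_congr rfl fun b _ => ?_
    rw [lintegral_const_mul _ (measurable_one.indicator (hCm b)), lintegral_indicator_one (hCm b)]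
  -- Expanding the product of finite sums gives one term for each assignment `c` of a level set to
  -- every position.
  have hL : ∀ ω, (∑' e : Fin k ↪ ℕ, ∏ l, (s (z (e l) ω)).1 l) * expNeg (∑' i, (s (z i ω)).2) =
      ∑ c : Fin k → B, (∏ l, (c l).1.1 l) *
        ((∑' e : Fin k ↪ ℕ, ∏ l, (C (c l)).indicator (1 : E → ℝ≥0∞) (z (e l) ω)) *
        expNeg (∑' i, ∑ b : B, b.1.2 * (C b).indicator (1 : E → ℝ≥0∞) (z i ω))) := by
    intro ω
    simp_rw [← hrep (fun p => p.2) rfl, ← mul_assoc, ← Finset.sum_mul]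
    congr 1
    simp_rw [← ENNReal.tsum_mul_left, ← Finset.prod_mul_distrib]
    rw [← Summable.tsum_finsetSum fun _ _ => ENNReal.summable]
    refine tsum_congr fun e => ?_
    have : ∀ l, (s (z (e l) ω)).1 l =
      ∑ b : B, b.1.1 l * (C b).indicator (1 : E → ℝ≥0∞) (z (e l) ω) :=
        fun l => hrep (fun p => p.1 l) rfl _
    simp_rw [this, Finset.prod_univ_sum, Fintype.piFinset_univ]
  have hmi : ∀ (b : B) i, Measurable fun ω => (C b).indicator (1 : E → ℝ≥0∞) (z i ω) :=
    fun b i => (measurable_one.indicator (hCm b)).comp (hz i)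
  simp_rw [hL]
  rw [lintegral_finsetSum _ fun c _ => by
    refine Measurable.const_mul (Measurable.mul ?_ ?_) _
    · exact Measurable.tsum fun e => Finset.measurable_prod _ fun l _ => hmi _ _
    · exact Measurable.expNeg (Measurable.tsum fun i =>
        Finset.measurable_sum _ fun b _ => (hmi _ _).const_mul _)]
  have hc : ∀ c : Fin k → B, ∫⁻ ω, (∏ l, (c l).1.1 l) *
        ((∑' e : Fin k ↪ ℕ, ∏ l, (C (c l)).indicator (1 : E → ℝ≥0∞) (z (e l) ω)) *
        expNeg (∑' i, ∑ b : B, b.1.2 * (C b).indicator (1 : E → ℝ≥0∞) (z i ω))) ∂P =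
      (∏ l, ((c l).1.1 l * expNeg (c l).1.2 * μ (C (c l)))) *
        expNeg (∑ b : B, (1 - expNeg b.1.2) * μ (C b)) := by
    intro c
    rw [lintegral_const_mul _ (by
      refine Measurable.mul ?_ ?_
      · exact Measurable.tsum fun e => Finset.measurable_prod _ fun l _ => hmi _ _
      · exact Measurable.expNeg (Measurable.tsum fun i =>
          Finset.measurable_sum _ fun b _ => (hmi _ _).const_mul _)),
      lintegral_prod_indicator_poisson hN C hCm hC hCS hCμ (fun b => b.1.2) c]
    rw [← mul_assoc, ← Finset.prod_mul_distrib]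
    simp_rw [mul_assoc]
  simp_rw [hc]
  rw [← Finset.sum_mul, hint (fun p => 1 - expNeg p.2) (by simp [expNeg_zero])]
  congr 1
  have : ∀ l, ∫⁻ y, (s y).1 l * expNeg (s y).2 ∂μ =
      ∑ b : B, b.1.1 l * expNeg b.1.2 * μ (C b) :=
    fun l => hint (fun p => p.1 l * expNeg p.2) (by simp)
  simp_rw [this, Finset.prod_univ_sum, Fintype.piFinset_univ]

end Poisson

/-! ### Passage from simple to measurable functions. -/

/-- Monotone approximation of a function by simple functions whose supports have finite measure. -/
theorem exists_simpleFunc_finMeasSupp_approx {E : Type*} [MeasurableSpace E] (μ : Measure E)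
    [SigmaFinite μ] {a : E → ℝ≥0∞} (ha : Measurable a) :
    ∃ s : ℕ → SimpleFunc E ℝ≥0∞, (∀ y, Monotone fun n => s n y) ∧
      (∀ y, Tendsto (fun n => s n y) atTop (𝓝 (a y))) ∧ (∀ n y, s n y ≤ a y) ∧
      (∀ n y, s n y ≠ ∞) ∧ ∀ n, μ {y | s n y ≠ 0} ≠ ∞ := by
  have happ : ∀ n y, ((SimpleFunc.eapprox a n).restrict (spanningSets μ n)) y =
      (spanningSets μ n).indicator (SimpleFunc.eapprox a n) y := fun n y => by
    rw [SimpleFunc.restrict_apply _ (measurableSet_spanningSets μ n)]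
  have hle : ∀ n y, SimpleFunc.eapprox a n y ≤ a y := fun n y => by
    rw [← SimpleFunc.iSup_eapprox_apply ha y]
    exact le_iSup (fun n => SimpleFunc.eapprox a n y) n
  refine ⟨fun n => (SimpleFunc.eapprox a n).restrict (spanningSets μ n), fun y n m hnm => ?_,
    fun y => ?_, fun n y => ?_, fun n y => ?_, fun n => ?_⟩
  · simp only [happ]
    refine (indicator_le_indicator_of_subset (monotone_spanningSets μ hnm)
      (fun _ => zero_le) y).trans ?_
    exact indicator_le_indicator (SimpleFunc.monotone_eapprox a hnm y)
  · simp only [happ]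
    have h1 : Tendsto (fun n => SimpleFunc.eapprox a n y) atTop (𝓝 (a y)) := by
      rw [← SimpleFunc.iSup_eapprox_apply ha y]
      exact tendsto_atTop_iSup fun n m hnm => SimpleFunc.monotone_eapprox a hnm y
    refine h1.congr' ?_
    filter_upwards [eventually_ge_atTop (spanningSetsIndex μ y)] with n hn
    rw [indicator_of_mem (mem_spanningSets_of_index_le μ y hn)]
  · rw [happ]
    exact (indicator_le_self _ _ y).trans (hle n y)
  · rw [happ]
    exact ne_top_of_le_ne_top (SimpleFunc.eapprox_lt_top a n y).ne (indicator_le_self _ _ y)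
  · refine ne_top_of_le_ne_top (measure_spanningSets_lt_top μ n).ne (measure_mono fun y hy => ?_)
    by_contra h
    exact hy (by rw [happ, indicator_of_notMem h])

theorem SimpleFunc.lintegral_ne_top_of_finMeasSupp {E : Type*} [MeasurableSpace E] {μ : Measure E}
    (s : SimpleFunc E ℝ≥0∞) (h1 : ∀ y, s y ≠ ∞) (h2 : μ {y | s y ≠ 0} ≠ ∞) :
    ∫⁻ y, s y ∂μ ≠ ∞ := by
  rw [SimpleFunc.lintegral_eq_lintegral]
  refine (SimpleFunc.FinMeasSupp.lintegral_lt_top ?_ (ae_of_all _ h1)).ne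
  rw [SimpleFunc.finMeasSupp_iff_support]
  exact h2.lt_top

/-- Multiplication on `[0, ∞]` is discontinuous at `(0, ∞)`. Monotonicity avoids this: a factor with
limit zero is identically zero. -/
theorem tendsto_finsetProd_of_monotone {ι : Type*} (s : Finset ι) {f : ι → ℕ → ℝ≥0∞}
    {g : ι → ℝ≥0∞} (hf : ∀ i, Monotone (f i)) (hg : ∀ i, Tendsto (f i) atTop (𝓝 (g i))) :
    Tendsto (fun n => ∏ i ∈ s, f i n) atTop (𝓝 (∏ i ∈ s, g i)) := by
  by_cases h : ∃ i ∈ s, g i = 0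
  · obtain ⟨i, hi, h0⟩ := h
    have hz : ∀ n, f i n = 0 := fun n =>
      le_antisymm (h0 ▸ (hf i).ge_of_tendsto (hg i) n) zero_le
    rw [Finset.prod_eq_zero hi h0]
    simp_rw [fun n => Finset.prod_eq_zero (f := fun i => f i n) hi (hz n)]
    exact tendsto_const_nhds
  · push Not at h
    classical
    induction s using Finset.induction_on with
    | empty => simp
    | insert a s ha ih =>
      simp_rw [Finset.prod_insert ha]
      refine ENNReal.Tendsto.mul (hg a) (Or.inl (h a (by simp)))
        (ih fun i hi => h i (by simp [hi])) (Or.inl ?_)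
      exact Finset.prod_ne_zero_iff.2 fun i hi => h i (by simp [hi])

section Poisson

variable {Ω E : Type*} [MeasurableSpace Ω] [MeasurableSpace E] {P : Measure Ω} {μ : Measure E}
  {S : Set E} {z : ℕ → Ω → E}

theorem lintegral_poisson_of_simpleFunc (hz : ∀ i, Measurable (z i))
    (hN : CoRM.IsPoissonRandomMeasure P
      (fun ω => (Measure.sum fun i => Measure.dirac (z i ω)).restrict S) μ)
    {k : ℕ} (a : Fin k → SimpleFunc E ℝ≥0∞) (v : SimpleFunc E ℝ≥0∞)
    (ha : ∀ l, μ {y | a l y ≠ 0} ≠ ∞) (hv : μ {y | v y ≠ 0} ≠ ∞)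
    (haS : ∀ l, ∀ y ∉ S, a l y = 0) (hvS : ∀ y ∉ S, v y = 0) :
    ∫⁻ ω, (∑' e : Fin k ↪ ℕ, ∏ l, a l (z (e l) ω)) * expNeg (∑' i, v (z i ω)) ∂P =
      (∏ l, ∫⁻ y, a l y * expNeg (v y) ∂μ) * expNeg (∫⁻ y, 1 - expNeg (v y) ∂μ) := by
  let s : E → (Fin k → ℝ≥0∞) × ℝ≥0∞ := fun y => (fun l => a l y, v y)
  have hs0 : ∀ y, s y ≠ 0 → (∃ l, a l y ≠ 0) ∨ v y ≠ 0 := by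
    intro y hy
    by_contra! h
    exact hy (Prod.ext (funext h.1) h.2)
  refine lintegral_poisson_of_finite_range hz hN s
    ((measurable_pi_lambda _ fun l => (a l).measurable).prodMk v.measurable) ?_ ?_ ?_
  · refine ((Finite.pi' fun l => (a l).finite_range).prod v.finite_range).subset ?_
    rintro _ ⟨y, rfl⟩
    exact ⟨fun l => ⟨y, rfl⟩, ⟨y, rfl⟩⟩
  · intro y hy
    by_contra h
    rcases hs0 y hy with ⟨l, hl⟩ | h'
    · exact hl (haS l y h)
    · exact h' (hvS y h)
  · refine ne_top_of_le_ne_top ?_ (measure_mono (show {y | s y ≠ 0} ⊆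
      (⋃ l, {y | a l y ≠ 0}) ∪ {y | v y ≠ 0} from fun y hy => ?_))
    · refine measure_union_ne_top (ne_top_of_le_ne_top ?_ (measure_iUnion_fintype_le μ _)) hv
      exact ENNReal.sum_ne_top.2 fun l _ => ha l
    · rcases hs0 y hy with h | h
      · exact Or.inl (mem_iUnion.2 h)
      · exact Or.inr h

/-- As `v` is approximated from below the exponentials decrease, so dominated convergence is needed.
The dominating function is the sum without exponential, which is integrable by the formula at `v =
0`. This is why the `a l` are still simple, finite and finitely supported in measure here. -/
theorem lintegral_poisson_of_simpleFunc_left [SigmaFinite μ] (hz : ∀ i, Measurable (z i))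
    (hN : CoRM.IsPoissonRandomMeasure P
      (fun ω => (Measure.sum fun i => Measure.dirac (z i ω)).restrict S) μ)
    {k : ℕ} (a : Fin k → SimpleFunc E ℝ≥0∞) {v : E → ℝ≥0∞} (hvm : Measurable v)
    (ha : ∀ l, μ {y | a l y ≠ 0} ≠ ∞) (ha' : ∀ l y, a l y ≠ ∞)
    (haS : ∀ l, ∀ y ∉ S, a l y = 0) (hvS : ∀ y ∉ S, v y = 0) :
    ∫⁻ ω, (∑' e : Fin k ↪ ℕ, ∏ l, a l (z (e l) ω)) * expNeg (∑' i, v (z i ω)) ∂P =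
      (∏ l, ∫⁻ y, a l y * expNeg (v y) ∂μ) * expNeg (∫⁻ y, 1 - expNeg (v y) ∂μ) := by
  obtain ⟨w, hmono, hlim, hle, -, hw⟩ := exists_simpleFunc_finMeasSupp_approx μ hvm
  have hF := fun p => lintegral_poisson_of_simpleFunc hz hN a (w p) ha (hw p) haS
    (fun y hy => le_antisymm ((hle p y).trans (hvS y hy).le) zero_le)
  have hmS : Measurable fun ω => ∑' e : Fin k ↪ ℕ, ∏ l, a l (z (e l) ω) :=
    Measurable.tsum fun e => Finset.measurable_prod _ fun l _ => (a l).measurable.comp (hz _)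
  have hai : ∀ l, ∫⁻ y, a l y ∂μ ≠ ∞ :=
    fun l => SimpleFunc.lintegral_ne_top_of_finMeasSupp _ (ha' l) (ha l)
  have hSfin : ∫⁻ ω, ∑' e : Fin k ↪ ℕ, ∏ l, a l (z (e l) ω) ∂P ≠ ∞ := by
    have h0 := lintegral_poisson_of_simpleFunc hz hN a 0 ha (by simp) haS (by simp)
    simp only [SimpleFunc.coe_zero, Pi.zero_apply, tsum_zero, expNeg_zero, mul_one, tsub_self,
      lintegral_zero] at h0
    rw [h0]
    exact ENNReal.prod_ne_top fun l _ => hai l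
  have hL : Tendsto (fun p => ∫⁻ ω, (∑' e : Fin k ↪ ℕ, ∏ l, a l (z (e l) ω)) *
      expNeg (∑' i, w p (z i ω)) ∂P) atTop
      (𝓝 (∫⁻ ω, (∑' e : Fin k ↪ ℕ, ∏ l, a l (z (e l) ω)) * expNeg (∑' i, v (z i ω)) ∂P)) := by
    refine tendsto_lintegral_of_dominated_convergence
      (fun ω => ∑' e : Fin k ↪ ℕ, ∏ l, a l (z (e l) ω)) (fun p => ?_) (fun p => ?_) hSfin ?_
    · exact hmS.mul (Measurable.expNeg (Measurable.tsum fun i => (w p).measurable.comp (hz i)))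
    · exact ae_of_all _ fun ω => mul_le_of_le_one_right' (expNeg_le_one _)
    · filter_upwards [ae_lt_top hmS hSfin] with ω hω
      refine ENNReal.Tendsto.const_mul ?_ (Or.inr hω.ne)
      exact (continuous_expNeg.tendsto _).comp
        (tendsto_tsum_of_monotone (fun i => hmono _) fun i => hlim _)
  have hR1 : ∀ l, Tendsto (fun p => ∫⁻ y, a l y * expNeg (w p y) ∂μ) atTop
      (𝓝 (∫⁻ y, a l y * expNeg (v y) ∂μ)) := by
    intro l
    refine tendsto_lintegral_of_dominated_convergence (fun y => a l y) (fun p => ?_) (fun p => ?_)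
      (hai l) (ae_of_all _ fun y => ?_)
    · exact (a l).measurable.mul (w p).measurable.expNeg
    · exact ae_of_all _ fun y => mul_le_of_le_one_right' (expNeg_le_one _)
    · exact ENNReal.Tendsto.const_mul ((continuous_expNeg.tendsto _).comp (hlim y))
        (Or.inr (ha' l y))
  have hR1' : ∀ l, ∫⁻ y, a l y * expNeg (v y) ∂μ ≠ ∞ := fun l =>
    ne_top_of_le_ne_top (hai l) (lintegral_mono fun y => mul_le_of_le_one_right' (expNeg_le_one _))
  have hR2 : Tendsto (fun p => ∫⁻ y, 1 - expNeg (w p y) ∂μ) atTop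
      (𝓝 (∫⁻ y, 1 - expNeg (v y) ∂μ)) := by
    refine lintegral_tendsto_of_tendsto_of_monotone (fun p => ?_) (ae_of_all _ fun y n m hnm => ?_)
      (ae_of_all _ fun y => ?_)
    · exact (measurable_const.sub (w p).measurable.expNeg).aemeasurable
    · exact tsub_le_tsub_left (expNeg_antitone (hmono y hnm)) _
    · exact ENNReal.Tendsto.sub tendsto_const_nhds
        ((continuous_expNeg.tendsto _).comp (hlim y)) (Or.inl (by simp))
  refine tendsto_nhds_unique hL ?_
  simp_rw [hF]
  refine ENNReal.Tendsto.mul ?_ (Or.inr (expNeg_ne_top _))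
    ((continuous_expNeg.tendsto _).comp hR2) (Or.inr (ENNReal.prod_ne_top fun l _ => hR1' l))
  exact ENNReal.tendsto_finsetProd_of_ne_top _ (fun l _ => hR1 l) (fun l _ => hR1' l)

/-- The multivariate Mecke formula for products, together with the Laplace functional of a Poisson
random measure. -/
theorem lintegral_poisson [SigmaFinite μ] (hz : ∀ i, Measurable (z i))
    (hN : CoRM.IsPoissonRandomMeasure P
      (fun ω => (Measure.sum fun i => Measure.dirac (z i ω)).restrict S) μ)
    {k : ℕ} {a : Fin k → E → ℝ≥0∞} {v : E → ℝ≥0∞} (ham : ∀ l, Measurable (a l))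
    (hvm : Measurable v) (haS : ∀ l, ∀ y ∉ S, a l y = 0) (hvS : ∀ y ∉ S, v y = 0) :
    ∫⁻ ω, (∑' e : Fin k ↪ ℕ, ∏ l, a l (z (e l) ω)) * expNeg (∑' i, v (z i ω)) ∂P =
      (∏ l, ∫⁻ y, a l y * expNeg (v y) ∂μ) * expNeg (∫⁻ y, 1 - expNeg (v y) ∂μ) := by
  choose s hmono hlim hle htop hs using
    fun l => exists_simpleFunc_finMeasSupp_approx μ (ham l)
  have hF := fun n => lintegral_poisson_of_simpleFunc_left hz hN (fun l => s l n) hvm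
    (fun l => hs l n) (fun l => htop l n)
    (fun l y hy => le_antisymm ((hle l n y).trans (haS l y hy).le) zero_le) hvS
  -- With `v` fixed, both sides increase with the approximations of the `a l`, so monotone
  -- convergence needs no integrability.
  have hmonoprod : ∀ y : Fin k → E, Monotone fun n => ∏ l, s l n (y l) := fun y n m hnm =>
    Finset.prod_le_prod' fun l _ => hmono l (y l) hnm
  have hL : Tendsto (fun n => ∫⁻ ω, (∑' e : Fin k ↪ ℕ, ∏ l, s l n (z (e l) ω)) *
      expNeg (∑' i, v (z i ω)) ∂P) atTop
      (𝓝 (∫⁻ ω, (∑' e : Fin k ↪ ℕ, ∏ l, a l (z (e l) ω)) * expNeg (∑' i, v (z i ω)) ∂P)) := by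
    refine lintegral_tendsto_of_tendsto_of_monotone (fun n => ?_)
      (ae_of_all _ fun ω n m hnm => ?_) (ae_of_all _ fun ω => ?_)
    · refine Measurable.aemeasurable (Measurable.mul (Measurable.tsum fun e => ?_)
        (Measurable.expNeg (Measurable.tsum fun i => hvm.comp (hz i))))
      exact Finset.measurable_prod _ fun l _ => (s l n).measurable.comp (hz _)
    · exact mul_le_mul_left (ENNReal.tsum_le_tsum fun e => hmonoprod _ hnm) _
    · exact ENNReal.Tendsto.mul_const (tendsto_tsum_of_monotone (fun e => hmonoprod _) fun e =>
        tendsto_finsetProd_of_monotone _ (fun l => hmono l _) (fun l => hlim l _))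
        (Or.inr (expNeg_ne_top _))
  refine tendsto_nhds_unique hL ?_
  simp_rw [hF]
  refine ENNReal.Tendsto.mul_const (tendsto_finsetProd_of_monotone _ (fun l n m hnm => ?_)
    fun l => ?_) (Or.inr (expNeg_ne_top _))
  · exact lintegral_mono fun y => mul_le_mul_left (hmono l y hnm) _
  · refine lintegral_tendsto_of_tendsto_of_monotone (fun n => ?_)
      (ae_of_all _ fun y n m hnm => ?_) (ae_of_all _ fun y => ?_)
    · exact ((s l n).measurable.mul hvm.expNeg).aemeasurable
    · exact mul_le_mul_left (hmono l y hnm) _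
    · exact ENNReal.Tendsto.mul_const (hlim l y) (Or.inr (expNeg_ne_top _))

end Poisson

theorem expNeg_eq_one_iff {a : ℝ≥0∞} : expNeg a = 1 ↔ a = 0 := by
  refine ⟨fun h => ?_, fun h => h ▸ expNeg_zero⟩
  rw [← expNeg_zero] at h
  have := neg_injective (EReal.exp_strictMono.injective h)
  exact_mod_cast this

/-! ### Poisson processes with independent marks. -/

section Marked

variable {Ω E Y : Type*} [MeasurableSpace Ω] [MeasurableSpace E] [MeasurableSpace Y]
  {P : Measure Ω} {μ : Measure E} {S : Set E} {z : ℕ → Ω → E} {m : ℕ → Ω → Y} {κ : Measure Y}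

/-- Independent marks can be integrated out, one point at a time. -/
theorem lintegral_prod_range_marks [IsProbabilityMeasure P] (hz : ∀ i, Measurable (z i))
    (hm : ∀ i, Measurable (m i)) (hlaw : ∀ i, HasLaw (m i) κ P) (hind : iIndepFun m P)
    (hmz : IndepFun (fun ω i => m i ω) (fun ω i => z i ω) P)
    {G : ℕ → E → Y → ℝ≥0∞} (hG : ∀ i, Measurable (Function.uncurry (G i))) (M : ℕ) :
    ∫⁻ ω, ∏ i ∈ Finset.range M, G i (z i ω) (m i ω) ∂P =
      ∫⁻ ω, ∏ i ∈ Finset.range M, ∫⁻ y, G i (z i ω) y ∂κ ∂P := by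
  have hm' : Measurable fun ω i => m i ω := measurable_pi_lambda _ hm
  have hz' : Measurable fun ω i => z i ω := measurable_pi_lambda _ hz
  have hF : Measurable fun p : (ℕ → Y) × (ℕ → E) =>
      ∏ i ∈ Finset.range M, G i (p.2 i) (p.1 i) := by
    refine Finset.measurable_prod _ fun i _ => ?_
    have h : Measurable fun p : (ℕ → Y) × (ℕ → E) => (p.2 i, p.1 i) :=
      ((measurable_pi_apply i).comp measurable_snd).prodMk
        ((measurable_pi_apply i).comp measurable_fst)
    exact (hG i).comp h
  have hmap := (indepFun_iff_map_prod_eq_prod_map_map hm'.aemeasurable hz'.aemeasurable).1 hmz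
  have : IsProbabilityMeasure (P.map fun ω i => m i ω) :=
    Measure.isProbabilityMeasure_map hm'.aemeasurable
  have : IsProbabilityMeasure (P.map fun ω i => z i ω) :=
    Measure.isProbabilityMeasure_map hz'.aemeasurable
  have h1 := lintegral_map (μ := P) hF (hm'.prodMk hz')
  -- The marks are independent of the points, so the points can be frozen; the independence of the
  -- marks among themselves then splits the inner integral.
  rw [hmap, lintegral_prod_symm' _ hF, lintegral_map hF.lintegral_prod_left' hz'] at h1
  rw [← h1]
  refine lintegral_congr fun ω => ?_
  have hGi : ∀ i, Measurable (G i (z i ω)) := fun i => (hG i).comp measurable_prodMk_left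
  refine (lintegral_map (hF.comp (measurable_prodMk_right (y := fun i => z i ω))) hm').trans ?_
  have h2 := lintegral_prod_eq_prod_lintegral_of_indepFun (Finset.range M) _
    (hind.comp (fun i => G i (z i ω)) hGi) (fun i => (hGi i).comp (hm i))
  refine h2.trans (Finset.prod_congr rfl fun i _ => ?_)
  exact (hlaw i).lintegral_comp (hGi i).aemeasurable

theorem prod_ite_embedding_eq {k : ℕ} {N : Type*} [CommMonoid N] (e : Fin k ↪ ℕ) (F : Fin k → N)
    (l : Fin k) : (∏ l', if e l' = e l then F l' else 1) = F l := by
  simp [e.injective.eq_iff]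

theorem prod_range_prod_ite_embedding {k : ℕ} {N : Type*} [CommMonoid N] (e : Fin k ↪ ℕ)
    (F : Fin k → ℕ → N) {M : ℕ} (hM : ∀ l, e l < M) :
    ∏ i ∈ Finset.range M, ∏ l, (if e l = i then F l i else 1) = ∏ l, F l (e l) := by
  rw [Finset.prod_comm]
  refine Finset.prod_congr rfl fun l _ => ?_
  rw [Finset.prod_ite_eq, if_pos (Finset.mem_range.2 (hM l))]

theorem tendsto_prod_range_embedding {k : ℕ} (e : Fin k ↪ ℕ) (F : Fin k → ℕ → ℝ≥0∞)
    (hF : ∀ l i, F l i ≠ ∞) (w : ℕ → ℝ≥0∞) :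
    Tendsto (fun M => ∏ i ∈ Finset.range M,
      ((∏ l, if e l = i then F l i else 1) * expNeg (w i))) atTop
      (𝓝 ((∏ l, F l (e l)) * expNeg (∑' i, w i))) := by
  have h := ENNReal.Tendsto.const_mul (a := ∏ l, F l (e l)) (tendsto_prod_expNeg w)
    (Or.inr (ENNReal.prod_ne_top fun l _ => hF l _))
  refine h.congr' ?_
  have hev : ∀ᶠ M in atTop, ∀ l, e l < M := eventually_all.2 fun l => eventually_gt_atTop _
  filter_upwards [hev] with M hM
  rw [Finset.prod_mul_distrib, prod_range_prod_ite_embedding e F hM]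

/-- Points of a Poisson process with independent marks: a product over distinct marked points can
be replaced by its conditional mean given the points. -/
theorem lintegral_marked_eq [IsProbabilityMeasure P] (hz : ∀ i, Measurable (z i))
    (hm : ∀ i, Measurable (m i)) (hlaw : ∀ i, HasLaw (m i) κ P) (hind : iIndepFun m P)
    (hmz : IndepFun (fun ω i => m i ω) (fun ω i => z i ω) P) [IsProbabilityMeasure κ]
    {k : ℕ} {g : Fin k → E → Y → ℝ≥0∞} {q : E → Y → ℝ≥0∞} {a : Fin k → E → ℝ≥0∞}
    {v : E → ℝ≥0∞} {K : ℝ≥0∞} (hK : K ≠ ∞)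
    (hg : ∀ l, Measurable (Function.uncurry (g l))) (hq : Measurable (Function.uncurry q))
    (hgtop : ∀ l x y, g l x y ≠ ∞) (hgK : ∀ l x y, g l x y * expNeg (q x y) ≤ K)
    (hatop : ∀ l x, a l x ≠ ∞)
    (hv : ∀ x, expNeg (v x) = ∫⁻ y, expNeg (q x y) ∂κ)
    (ha : ∀ l x, a l x * expNeg (v x) = ∫⁻ y, g l x y * expNeg (q x y) ∂κ) (e : Fin k ↪ ℕ) :
    ∫⁻ ω, (∏ l, g l (z (e l) ω) (m (e l) ω)) * expNeg (∑' i, q (z i ω) (m i ω)) ∂P =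
      ∫⁻ ω, (∏ l, a l (z (e l) ω)) * expNeg (∑' i, v (z i ω)) ∂P := by
  -- The integrand is written as an infinite product over indices. Since `e` is injective, index `i`
  -- carries at most one factor `g l`, which lets the marks be averaged index by index.
  let G : ℕ → E → Y → ℝ≥0∞ := fun i x y => (∏ l, if e l = i then g l x y else 1) * expNeg (q x y)
  have hGm : ∀ i, Measurable (Function.uncurry (G i)) := by
    intro i
    refine Measurable.mul (Finset.measurable_prod _ fun l _ => ?_) hq.expNeg
    by_cases h : e l = i
    · simp only [h, if_true]
      exact hg l
    · simp only [h, if_false]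
      exact measurable_const
  have hGbar : ∀ i x, ∫⁻ y, G i x y ∂κ = (∏ l, if e l = i then a l x else 1) * expNeg (v x) := by
    intro i x
    by_cases h : ∃ l, e l = i
    · obtain ⟨l, rfl⟩ := h
      simp only [G]
      rw [prod_ite_embedding_eq e (fun l => a l x), ha]
      refine lintegral_congr fun y => ?_
      rw [prod_ite_embedding_eq e (fun l => g l x y)]
    · push Not at h
      simp [G, h, hv]
  -- At most `k` indices have a bound above `1`, so all partial products are at most `max 1 K ^ k`,
  -- a constant suitable for dominated convergence.
  let B : ℕ → ℝ≥0∞ := fun i => ∏ l, if e l = i then max 1 K else 1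
  have hGB : ∀ i x y, G i x y ≤ B i := by
    intro i x y
    by_cases h : ∃ l, e l = i
    · obtain ⟨l, rfl⟩ := h
      simp only [G, B]
      rw [prod_ite_embedding_eq e (fun l => g l x y), prod_ite_embedding_eq e (fun _ => max 1 K)]
      exact (hgK l x y).trans (le_max_right _ _)
    · push Not at h
      simp [G, B, h, expNeg_le_one]
  have hB : ∀ M, ∏ i ∈ Finset.range M, B i ≤ max 1 K ^ k := by
    intro M
    simp only [B]
    rw [Finset.prod_comm]
    calc _ ≤ ∏ l : Fin k, max 1 K := by
          refine Finset.prod_le_prod' fun l _ => ?_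
          rw [Finset.prod_ite_eq]
          split_ifs
          · exact le_rfl
          · exact le_max_left _ _
      _ = _ := by simp
  have hbound : ∫⁻ _ : Ω, max 1 K ^ k ∂P ≠ ∞ := by
    rw [lintegral_const, measure_univ, mul_one]
    exact ENNReal.pow_ne_top (by simp [hK])
  have hL : Tendsto (fun M => ∫⁻ ω, ∏ i ∈ Finset.range M, G i (z i ω) (m i ω) ∂P) atTop
      (𝓝 (∫⁻ ω, (∏ l, g l (z (e l) ω) (m (e l) ω)) * expNeg (∑' i, q (z i ω) (m i ω)) ∂P)) := by
    refine tendsto_lintegral_of_dominated_convergence (fun _ => max 1 K ^ k) (fun M => ?_)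
      (fun M => ae_of_all _ fun ω => ?_) hbound (ae_of_all _ fun ω => ?_)
    · exact Finset.measurable_prod _ fun i _ => (hGm i).comp ((hz i).prodMk (hm i))
    · exact (Finset.prod_le_prod' fun i _ => hGB i _ _).trans (hB M)
    · exact tendsto_prod_range_embedding e (fun l i => g l (z i ω) (m i ω))
        (fun l i => hgtop _ _ _) (fun i => q (z i ω) (m i ω))
  have hR : Tendsto (fun M => ∫⁻ ω, ∏ i ∈ Finset.range M, ∫⁻ y, G i (z i ω) y ∂κ ∂P) atTop
      (𝓝 (∫⁻ ω, (∏ l, a l (z (e l) ω)) * expNeg (∑' i, v (z i ω)) ∂P)) := by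
    refine tendsto_lintegral_of_dominated_convergence (fun _ => max 1 K ^ k) (fun M => ?_)
      (fun M => ae_of_all _ fun ω => ?_) hbound (ae_of_all _ fun ω => ?_)
    · exact Finset.measurable_prod _ fun i _ => (hGm i).lintegral_prod_right'.comp (hz i)
    · refine (Finset.prod_le_prod' fun i _ => ?_).trans (hB M)
      exact (lintegral_mono fun y => hGB i _ y).trans (by simp)
    · simp_rw [hGbar]
      exact tendsto_prod_range_embedding e (fun l i => a l (z i ω))
        (fun l i => hatop _ _) (fun i => v (z i ω))
  refine tendsto_nhds_unique hL ?_
  simp_rw [lintegral_prod_range_marks hz hm hlaw hind hmz hGm]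
  exact hR

/-- The multivariate Mecke formula for products and exponentials of a Poisson process with
independent marks. -/
theorem lintegral_marked_poisson [IsProbabilityMeasure P] [SigmaFinite μ]
    (hz : ∀ i, Measurable (z i))
    (hN : CoRM.IsPoissonRandomMeasure P
      (fun ω => (Measure.sum fun i => Measure.dirac (z i ω)).restrict S) μ)
    (hm : ∀ i, Measurable (m i)) (hlaw : ∀ i, HasLaw (m i) κ P) (hind : iIndepFun m P)
    (hmz : IndepFun (fun ω i => m i ω) (fun ω i => z i ω) P) [IsProbabilityMeasure κ]
    {k : ℕ} {g : Fin k → E → Y → ℝ≥0∞} {q : E → Y → ℝ≥0∞} {K : ℝ≥0∞} (hK : K ≠ ∞)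
    (hg : ∀ l, Measurable (Function.uncurry (g l))) (hq : Measurable (Function.uncurry q))
    (hgtop : ∀ l x y, g l x y ≠ ∞) (hgK : ∀ l x y, g l x y * expNeg (q x y) ≤ K)
    (hq0 : ∀ x, ∫⁻ y, expNeg (q x y) ∂κ ≠ 0)
    (hgS : ∀ l, ∀ x ∉ S, ∀ y, g l x y = 0) (hqS : ∀ x ∉ S, ∀ y, q x y = 0) :
    ∫⁻ ω, (∑' e : Fin k ↪ ℕ, ∏ l, g l (z (e l) ω) (m (e l) ω)) *
        expNeg (∑' i, q (z i ω) (m i ω)) ∂P =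
      (∏ l, ∫⁻ x, ∫⁻ y, g l x y * expNeg (q x y) ∂κ ∂μ) *
        expNeg (∫⁻ x, 1 - ∫⁻ y, expNeg (q x y) ∂κ ∂μ) := by
  have hφm : Measurable fun x => ∫⁻ y, expNeg (q x y) ∂κ := hq.expNeg.lintegral_prod_right'
  have hφ1 : ∀ x, ∫⁻ y, expNeg (q x y) ∂κ ≤ 1 := fun x =>
    (lintegral_mono fun y => expNeg_le_one _).trans (by simp)
  -- `v` is minus the logarithm of the mean of `e^{-q}`, and dividing by that nonzero mean makes `a
  -- e^{-v}` the mean of `g e^{-q}`. The unmarked formula for `a` and `v` is then the claim.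
  obtain ⟨v, hvm, hv⟩ := exists_measurable_expNeg_eq hφm hφ1
  let a : Fin k → E → ℝ≥0∞ := fun l x =>
    (∫⁻ y, g l x y * expNeg (q x y) ∂κ) / ∫⁻ y, expNeg (q x y) ∂κ
  have hgm : ∀ l, Measurable fun x => ∫⁻ y, g l x y * expNeg (q x y) ∂κ := fun l =>
    ((hg l).mul hq.expNeg).lintegral_prod_right'
  have ham : ∀ l, Measurable (a l) := fun l => (hgm l).div hφm
  have ha : ∀ l x, a l x * expNeg (v x) = ∫⁻ y, g l x y * expNeg (q x y) ∂κ := by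
    intro l x
    rw [hv]
    exact ENNReal.div_mul_cancel (hq0 x) (ne_top_of_le_ne_top (by simp) (hφ1 x))
  have hatop : ∀ l x, a l x ≠ ∞ := fun l x =>
    ENNReal.div_ne_top (ne_top_of_le_ne_top hK ((lintegral_mono fun y => hgK l x y).trans
      (by simp))) (hq0 x)
  have haS : ∀ l, ∀ x ∉ S, a l x = 0 := fun l x hx => by simp [a, hgS l x hx]
  have hvS : ∀ x ∉ S, v x = 0 := fun x hx => by
    rw [← expNeg_eq_one_iff, hv]
    simp [hqS x hx, expNeg_zero]
  have key := lintegral_poisson hz hN ham hvm haS hvS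
  simp_rw [ha, hv] at key
  rw [← key]
  simp_rw [← ENNReal.tsum_mul_right]
  rw [lintegral_tsum, lintegral_tsum]
  · refine tsum_congr fun e => ?_
    exact lintegral_marked_eq hz hm hlaw hind hmz hK hg hq hgtop hgK hatop hv ha e
  · intro e
    refine Measurable.aemeasurable (Measurable.mul (Finset.measurable_prod _ fun l _ =>
      (ham l).comp (hz _)) (Measurable.expNeg (Measurable.tsum fun i => hvm.comp (hz i))))
  · intro e
    refine Measurable.aemeasurable (Measurable.mul (Finset.measurable_prod _ fun l _ =>
      (hg l).comp ((hz _).prodMk (hm _)))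
      (Measurable.expNeg (Measurable.tsum fun i => hq.comp ((hz i).prodMk (hm i)))))

end Marked

/-! ### Finiteness of the intensity and distinctness of the locations. -/

/-- By Markov's inequality the sets where `min 1 z ≥ 1/(n+1)` have finite measure; they cover `(0,
∞)`, and `Iic 0` is null for the restriction. -/
theorem sigmaFinite_restrict_Ioi_of_levy {ν : Measure ℝ}
    (h : ∫⁻ z in Ioi 0, min 1 (ENNReal.ofReal z) ∂ν < ∞) : SigmaFinite (ν.restrict (Ioi 0)) := by
  have hm : Measurable fun z : ℝ => min 1 (ENNReal.ofReal z) := by fun_prop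
  let A : ℕ → Set ℝ := fun n => {z | ((n : ℝ≥0∞) + 1)⁻¹ ≤ min 1 (ENNReal.ofReal z)}
  have hA : ∀ n, ν.restrict (Ioi 0) (A n) < ∞ := by
    intro n
    refine (meas_ge_le_lintegral_div hm.aemeasurable (by simp)
      (ENNReal.inv_ne_top.2 (by simp))).trans_lt ?_
    exact ENNReal.div_lt_top h.ne (by simp)
  refine Measure.sigmaFinite_of_countable (S := insert (Iic 0) (range A))
    ((countable_range A).insert _) ?_ ?_
  · rintro s (rfl | ⟨n, rfl⟩)
    · rw [Measure.restrict_apply measurableSet_Iic, Iic_inter_Ioi, Ioc_self, measure_empty]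
      exact ENNReal.zero_lt_top
    · exact hA n
  · refine eq_univ_of_forall fun z => ?_
    rcases le_or_gt z 0 with hz | hz
    · exact ⟨Iic 0, Or.inl rfl, hz⟩
    · obtain ⟨n, hn⟩ := ENNReal.exists_inv_nat_lt (a := min 1 (ENNReal.ofReal z))
        (by simpa using hz)
      refine ⟨A n, Or.inr ⟨n, rfl⟩, le_trans ?_ hn.le⟩
      exact ENNReal.inv_le_inv.2 le_self_add

/-- The points of a Poisson process with diffuse second marginal have almost surely distinct second
components. -/
theorem ae_snd_injOn_of_poisson {Ω T 𝕏 : Type*} [MeasurableSpace Ω] [MeasurableSpace T]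
    [MeasurableSpace 𝕏] [MeasurableEq 𝕏] [MeasurableSingletonClass 𝕏] {P : Measure Ω}
    {ρ : Measure T} [SigmaFinite ρ]
    {α : Measure 𝕏} [SigmaFinite α] [NullSingletonClass α] {S : Set (T × 𝕏)} (hS : MeasurableSet S)
    {z : ℕ → Ω → T × 𝕏} (hz : ∀ i, Measurable (z i))
    (hN : CoRM.IsPoissonRandomMeasure P
      (fun ω => (Measure.sum fun i => Measure.dirac (z i ω)).restrict S) (ρ.prod α)) :
    ∀ᵐ ω ∂P, ∀ i j, z i ω ∈ S → z j ω ∈ S → (z i ω).2 = (z j ω).2 → i = j := by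
  classical
  let μ := ρ.prod α
  -- `M` is the second factorial moment measure on `S ×ˢ S`. The formula with `k = 2` and `v = 0`
  -- identifies it with a product measure, which does not charge pairs with equal locations because
  -- `α` is diffuse.
  let M : Measure ((T × 𝕏) × (T × 𝕏)) := Measure.sum fun e : Fin 2 ↪ ℕ =>
    (P.map fun ω => (z (e 0) ω, z (e 1) ω)).restrict (S ×ˢ S)
  have hze : ∀ e : Fin 2 ↪ ℕ, Measurable fun ω => (z (e 0) ω, z (e 1) ω) :=
    fun e => (hz _).prodMk (hz _)
  have hM : (μ.restrict S).prod (μ.restrict S) = M := by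
    refine Measure.prod_eq fun A B hA hB => ?_
    have key := lintegral_poisson hz hN (k := 2) (v := fun _ => 0)
      (a := ![(A ∩ S).indicator 1, (B ∩ S).indicator 1]) (fun l => by
        fin_cases l
        · exact measurable_one.indicator (hA.inter hS)
        · exact measurable_one.indicator (hB.inter hS)) measurable_const (fun l y hy => by
        fin_cases l <;> simp [hy]) (fun _ _ => rfl)
    simp only [Fin.prod_univ_two, Matrix.cons_val_zero, Matrix.cons_val_one, tsum_zero,
      expNeg_zero, mul_one, tsub_self, lintegral_zero, lintegral_indicator_one (hA.inter hS),
      lintegral_indicator_one (hB.inter hS)] at key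
    have hprod : ∀ e : Fin 2 ↪ ℕ, Measurable fun ω =>
        (A ∩ S).indicator (1 : T × 𝕏 → ℝ≥0∞) (z (e 0) ω) * (B ∩ S).indicator 1 (z (e 1) ω) :=
      fun e => ((measurable_one.indicator (hA.inter hS)).comp (hz _)).mul
        ((measurable_one.indicator (hB.inter hS)).comp (hz _))
    rw [Measure.restrict_apply hA, Measure.restrict_apply hB, ← key,
      Measure.sum_apply _ (hA.prod hB), lintegral_tsum fun e => (hprod e).aemeasurable]
    refine tsum_congr fun e => ?_
    rw [Measure.restrict_apply (hA.prod hB), Measure.map_apply (hze e)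
      ((hA.prod hB).inter (hS.prod hS)), ← lintegral_indicator_one
      (hze e ((hA.prod hB).inter (hS.prod hS)))]
    refine lintegral_congr fun ω => ?_
    have hmem : ω ∈ (fun ω => (z (e 0) ω, z (e 1) ω)) ⁻¹' (A ×ˢ B ∩ S ×ˢ S) ↔
        z (e 0) ω ∈ A ∩ S ∧ z (e 1) ω ∈ B ∩ S := by
      rw [prod_inter_prod]
      exact Iff.rfl
    by_cases h1 : z (e 0) ω ∈ A ∩ S <;> by_cases h2 : z (e 1) ω ∈ B ∩ S <;>
      rw [indicator_apply, indicator_apply, indicator_apply, if_congr hmem rfl rfl] <;>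
      simp [h1, h2]
  have hD : MeasurableSet {p : (T × 𝕏) × (T × 𝕏) | p.1.2 = p.2.2} :=
    measurableSet_eq_fun (by fun_prop) (by fun_prop)
  have hD0 : M {p | p.1.2 = p.2.2} = 0 := by
    rw [← hM, Measure.prod_restrict]
    refine Measure.absolutelyContinuous_of_le Measure.restrict_le_self ?_
    rw [Measure.measure_prod_null hD]
    refine ae_of_all _ fun p => ?_
    have : Prod.mk p ⁻¹' {p : (T × 𝕏) × (T × 𝕏) | p.1.2 = p.2.2} = univ ×ˢ {p.2} := by
      ext y
      simp [eq_comm]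
    change μ (Prod.mk p ⁻¹' {p : (T × 𝕏) × (T × 𝕏) | p.1.2 = p.2.2}) = 0
    rw [this]
    simp [μ, Measure.prod_prod]
  rw [Measure.sum_apply _ hD, ENNReal.tsum_eq_zero] at hD0
  have hae : ∀ e : Fin 2 ↪ ℕ, ∀ᵐ ω ∂P,
      ¬ ((z (e 0) ω).2 = (z (e 1) ω).2 ∧ z (e 0) ω ∈ S ∧ z (e 1) ω ∈ S) := by
    intro e
    have := hD0 e
    rw [Measure.restrict_apply hD, Measure.map_apply (hze e) (hD.inter (hS.prod hS))] at this
    rw [ae_iff]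
    simp only [not_not]
    exact this
  filter_upwards [ae_all_iff.2 hae] with ω hω i j hi hj hij
  by_contra hne
  refine hω ⟨![i, j], fun a b hab => ?_⟩ ⟨hij, hi, hj⟩
  fin_cases a <;> fin_cases b <;> simp_all

/-! ### The Gamma integral, an exponential bound and distributivity. -/

theorem lintegral_gamma_expNeg {T : ℝ≥0∞} (h0 : T ≠ 0) (hT : T ≠ ∞) {N : ℕ} (hN : 1 ≤ N) :
    ∫⁻ u in Ioi (0 : ℝ), ENNReal.ofReal (u ^ ((N : ℝ) - 1) / Real.Gamma N) *
      expNeg (ENNReal.ofReal u * T) = T⁻¹ ^ N := by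
  obtain ⟨t, ht, rfl⟩ : ∃ t : ℝ, 0 < t ∧ T = ENNReal.ofReal t :=
    ⟨T.toReal, ENNReal.toReal_pos h0 hT, (ENNReal.ofReal_toReal hT).symm⟩
  have hN' : (0 : ℝ) < N := by exact_mod_cast hN
  have hG := Real.Gamma_pos_of_pos hN'
  have hi := Real.integral_rpow_mul_exp_neg_mul_Ioi hN' ht
  have hint : IntegrableOn (fun u : ℝ => u ^ ((N : ℝ) - 1) * Real.exp (-(t * u))) (Ioi 0) :=
    .of_integral_ne_zero (by rw [hi]; positivity)
  calc _ = ∫⁻ u in Ioi (0 : ℝ), ENNReal.ofReal (Real.Gamma N)⁻¹ *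
        ENNReal.ofReal (u ^ ((N : ℝ) - 1) * Real.exp (-(t * u))) := by
        refine setLIntegral_congr_fun measurableSet_Ioi fun u hu => ?_
        have hu' : 0 < u := hu
        rw [← ENNReal.ofReal_mul hu'.le, expNeg_ofReal (by positivity),
          ← ENNReal.ofReal_mul (by positivity), ← ENNReal.ofReal_mul (by positivity)]
        congr 1
        rw [mul_comm u t]
        ring
    _ = _ := by
        rw [lintegral_const_mul _ (by fun_prop), ← ofReal_integral_eq_lintegral_ofReal hint
          ((ae_restrict_iff' measurableSet_Ioi).2 (ae_of_all _ fun u hu => by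
            have hu' : 0 < u := hu
            positivity)), hi, ← ENNReal.ofReal_mul (by positivity), ← ENNReal.ofReal_inv_of_pos ht,
          ← ENNReal.ofReal_pow (by positivity), Real.rpow_natCast]
        congr 1
        field_simp

/-- This is `(cY)^n / n! ≤ e^{cY}`. It yields the uniform bound `K` required by
`lintegral_marked_poisson`. -/
theorem pow_mul_expNeg_le {c : ℝ} (hc : 0 < c) {Y : ℝ≥0∞} (hY : Y ≠ ∞) (n : ℕ) :
    Y ^ n * expNeg (ENNReal.ofReal c * Y) ≤ ENNReal.ofReal (n.factorial / c ^ n) := by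
  obtain ⟨t, ht, rfl⟩ : ∃ t : ℝ, 0 ≤ t ∧ Y = ENNReal.ofReal t :=
    ⟨Y.toReal, ENNReal.toReal_nonneg, (ENNReal.ofReal_toReal hY).symm⟩
  rw [← ENNReal.ofReal_mul hc.le, expNeg_ofReal (by positivity), ← ENNReal.ofReal_pow ht,
    ← ENNReal.ofReal_mul (by positivity)]
  refine ENNReal.ofReal_le_ofReal ?_
  have h := Real.pow_div_factorial_le_exp (x := c * t) (by positivity) n
  rw [div_le_iff₀ (by positivity), mul_pow] at h
  rw [Real.exp_neg, ← div_eq_mul_inv, div_le_div_iff₀ (Real.exp_pos _) (by positivity)]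
  linarith

theorem prod_tsum_eq_tsum_prod_fin {n : ℕ} (f : Fin n → ℕ → ℝ≥0∞) :
    ∏ a, ∑' i, f a i = ∑' i : Fin n → ℕ, ∏ a, f a (i a) := by
  induction n with
  | zero => simp
  | succ n ih =>
    rw [Fin.prod_univ_succ, ih, ← (Fin.consEquiv fun _ : Fin (n + 1) => ℕ).tsum_eq,
      ENNReal.tsum_prod', ← ENNReal.tsum_mul_right]
    refine tsum_congr fun i => ?_
    rw [← ENNReal.tsum_mul_left]
    refine tsum_congr fun r => ?_
    simp [Fin.prod_univ_succ]

/-- Distributivity of finite products over sums in `[0, ∞]`. -/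
theorem prod_tsum_eq_tsum_prod {ι : Type*} [Fintype ι] (f : ι → ℕ → ℝ≥0∞) :
    ∏ a, ∑' i, f a i = ∑' i : ι → ℕ, ∏ a, f a (i a) := by
  let eq := Fintype.equivFin ι
  rw [← eq.symm.prod_comp, prod_tsum_eq_tsum_prod_fin,
    ← (Equiv.arrowCongr eq.symm (Equiv.refl ℕ)).tsum_eq]
  refine tsum_congr fun i => ?_
  rw [← eq.symm.prod_comp]
  simp [Equiv.arrowCongr]

/-! ### Integrals over the score of a single atom. -/

namespace CoRM

theorem orthant_eq_pi (d : ℕ) : orthant d = univ.pi fun _ => Ioi 0 := by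
  ext u
  simp [orthant]

theorem measurableSet_orthant (d : ℕ) : MeasurableSet (orthant d) := by
  rw [orthant_eq_pi]
  exact MeasurableSet.univ_pi fun _ => measurableSet_Ioi

theorem lintegral_orthant_prod {d : ℕ} {F : Fin d → ℝ → ℝ≥0∞} (hF : ∀ j, Measurable (F j)) :
    ∫⁻ u in orthant d, ∏ j, F j (u j) = ∏ j, ∫⁻ t in Ioi 0, F j t := by
  rw [orthant_eq_pi, volume_pi, Measure.restrict_pi_pi, lintegral_pi_fin_prod hF]

/-- The weight `∏ j (y_j s)^{n_j}` of an atom of height `s` with scores `y`. -/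
def scoreWeight {𝕏 : Type*} {d : ℕ} (n : Fin d → ℕ) (p : ℝ × 𝕏) (y : Fin d → ℝ) : ℝ≥0∞ :=
  ∏ j, (ENNReal.ofReal (y j) * ENNReal.ofReal p.1) ^ n j

/-- The exponent `∑ j u_j y_j s` of an atom of height `s` with scores `y`. -/
def scoreExponent {𝕏 : Type*} {d : ℕ} (u : Fin d → ℝ) (p : ℝ × 𝕏) (y : Fin d → ℝ) : ℝ≥0∞ :=
  ∑ j, ENNReal.ofReal (u j) * (ENNReal.ofReal (y j) * ENNReal.ofReal p.1)

/-- The law of the score vectors. -/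
def scoreLaw {d : ℕ} (h : (Fin d → ℝ) → ℝ≥0) : Measure (Fin d → ℝ) :=
  (volume.restrict (orthant d)).withDensity fun s => (h s : ℝ≥0∞)

section Score

variable {𝕏 : Type*} {d : ℕ}

theorem measurable_scoreWeight [MeasurableSpace 𝕏] (n : Fin d → ℕ) :
    Measurable (Function.uncurry (scoreWeight (𝕏 := 𝕏) n)) := by
  unfold scoreWeight Function.uncurry
  fun_prop

theorem measurable_scoreExponent [MeasurableSpace 𝕏] :
    Measurable fun p : (Fin d → ℝ) × (ℝ × 𝕏) × (Fin d → ℝ) => scoreExponent p.1 p.2.1 p.2.2 := by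
  unfold scoreExponent
  fun_prop

theorem scoreWeight_ne_top (n : Fin d → ℕ) (p : ℝ × 𝕏) (y : Fin d → ℝ) :
    scoreWeight n p y ≠ ∞ :=
  ENNReal.prod_ne_top fun j _ => ENNReal.pow_ne_top (by finiteness)

theorem scoreExponent_ne_top (u : Fin d → ℝ) (p : ℝ × 𝕏) (y : Fin d → ℝ) :
    scoreExponent u p y ≠ ∞ :=
  ENNReal.sum_ne_top.2 fun j _ => by finiteness

theorem scoreWeight_mul_expNeg (n : Fin d → ℕ) (u : Fin d → ℝ) (p : ℝ × 𝕏) (y : Fin d → ℝ) :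
    scoreWeight n p y * expNeg (scoreExponent u p y) =
      ∏ j, (ENNReal.ofReal (y j) * ENNReal.ofReal p.1) ^ n j *
        expNeg (ENNReal.ofReal (u j) * (ENNReal.ofReal (y j) * ENNReal.ofReal p.1)) := by
  rw [scoreWeight, scoreExponent, expNeg_sum, Finset.prod_mul_distrib]

theorem scoreWeight_mul_expNeg_le (n : Fin d → ℕ) {u : Fin d → ℝ} (hu : u ∈ orthant d)
    (p : ℝ × 𝕏) (y : Fin d → ℝ) : scoreWeight n p y * expNeg (scoreExponent u p y) ≤
      ∏ j, ENNReal.ofReal ((n j).factorial / u j ^ n j) := by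
  rw [scoreWeight_mul_expNeg]
  exact Finset.prod_le_prod' fun j _ => pow_mul_expNeg_le (hu j) (by finiteness) _

/-- Under the factorization of `h` the coordinates of a score vector are independent with density
`f`, so Tonelli on the orthant splits the integral. -/
theorem lintegral_scoreLaw {h : (Fin d → ℝ) → ℝ≥0} {f : ℝ → ℝ≥0} (hh : Measurable h)
    (hf : Measurable f) (hfac : Factorizes h f) {F : Fin d → ℝ → ℝ≥0∞}
    (hF : ∀ j, Measurable (F j)) :
    ∫⁻ y, ∏ j, F j (y j) ∂scoreLaw h = ∏ j, ∫⁻ t in Ioi 0, F j t * f t := by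
  have hFm : Measurable fun y : Fin d → ℝ => ∏ j, F j (y j) :=
    Finset.measurable_prod _ fun j _ => (hF j).comp (measurable_pi_apply j)
  rw [scoreLaw, lintegral_withDensity_eq_lintegral_mul _ (by fun_prop) hFm,
    ← lintegral_orthant_prod (F := fun j t => F j t * f t) fun j => by
      have := hF j
      fun_prop]
  refine setLIntegral_congr_fun (measurableSet_orthant d) fun y hy => ?_
  rw [Pi.mul_apply, hfac y hy, Finset.prod_mul_distrib, mul_comm, ENNReal.ofNNReal_finsetProd]

theorem lintegral_scoreWeight {h : (Fin d → ℝ) → ℝ≥0} {f : ℝ → ℝ≥0} (hh : Measurable h)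
    (hf : Measurable f) (hfac : Factorizes h f) (n : Fin d → ℕ) {u : Fin d → ℝ}
    (hu : u ∈ orthant d) {p : ℝ × 𝕏} (hp : 0 < p.1) :
    ∫⁻ y, scoreWeight n p y * expNeg (scoreExponent u p y) ∂scoreLaw h =
      ∏ j, scoreMoment f (u j) p.1 (n j) := by
  simp_rw [scoreWeight_mul_expNeg]
  rw [lintegral_scoreLaw hh hf hfac (F := fun j t =>
    (ENNReal.ofReal t * ENNReal.ofReal p.1) ^ n j *
        expNeg (ENNReal.ofReal (u j) * (ENNReal.ofReal t * ENNReal.ofReal p.1)))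
    fun j => by fun_prop]
  refine Finset.prod_congr rfl fun j _ => setLIntegral_congr_fun measurableSet_Ioi fun t ht => ?_
  have ht' : 0 < t := ht
  have huj : 0 < u j := hu j
  rw [← ENNReal.ofReal_mul ht'.le, ← ENNReal.ofReal_mul huj.le, expNeg_ofReal (by positivity),
    ← ENNReal.ofReal_pow (by positivity), ← ENNReal.ofReal_mul (by positivity)]
  ring_nf

theorem lintegral_expNeg_scoreExponent {h : (Fin d → ℝ) → ℝ≥0} {f : ℝ → ℝ≥0} (hh : Measurable h)
    (hf : Measurable f) (hfac : Factorizes h f) {u : Fin d → ℝ}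
    (hu : u ∈ orthant d) {p : ℝ × 𝕏} (hp : 0 < p.1) :
    ∫⁻ y, expNeg (scoreExponent u p y) ∂scoreLaw h =
      ∏ j, ∫⁻ m in Ioi 0, ENNReal.ofReal (Real.exp (-(u j * m * p.1))) * (f m : ℝ≥0∞) := by
  have := lintegral_scoreWeight hh hf hfac (fun _ => 0) hu hp
  simpa [scoreWeight, scoreMoment] using this

end Score

theorem lintegral_prod_fst {T 𝕏 : Type*} [MeasurableSpace T] [MeasurableSpace 𝕏] {ρ : Measure T}
    [SFinite ρ] {α : Measure 𝕏} [SFinite α] {F : T → ℝ≥0∞} (hF : Measurable F) :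
    ∫⁻ p, F p.1 ∂ρ.prod α = α univ * ∫⁻ t, F t ∂ρ := by
  have := lintegral_prod_mul (μ := ρ) (ν := α) (f := F) (g := fun _ => 1) hF.aemeasurable
    aemeasurable_const
  simpa [mul_comm] using this

/-! ### Moments of the unnormalized measures under exponential weights. -/

section Main

variable {Ω 𝕏 : Type*} [MeasurableSpace Ω] {P : Measure Ω} [IsProbabilityMeasure P]
  [MeasurableSpace 𝕏] {d : ℕ} {ν : Measure ℝ} {α : Measure 𝕏} [IsFiniteMeasure α]
  {h : (Fin d → ℝ) → ℝ≥0} {f : ℝ → ℝ≥0} {J : ℕ → Ω → ℝ} {x : ℕ → Ω → 𝕏}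
  {m : ℕ → Ω → Fin d → ℝ}

/-- The joint moments of the unnormalized compound random measures, weighted by their Laplace
functional. -/
theorem lintegral_laplace_moments (hf : IsDensity f) (hcorm : IsCoRM P ν α h J x m)
    (hfac : Factorizes h f) {k : ℕ} {n : Fin k → Fin d → ℕ} (hn : ∀ l, 1 ≤ ∑ j, n l j)
    {u : Fin d → ℝ} (hu : u ∈ orthant d) :
    ∫⁻ ω, (∑' e : Fin k ↪ ℕ, ∏ l, scoreWeight (n l) (J (e l) ω, x (e l) ω) (m (e l) ω)) *
        expNeg (∑' i, scoreExponent u (J i ω, x i ω) (m i ω)) ∂P =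
      expNeg (α univ * laplaceExponent ν f u) *
        (α univ ^ k * ∏ l, ∫⁻ s in Ioi 0, ∏ j, scoreMoment f (u j) s (n l j) ∂ν) := by
  have hσ := sigmaFinite_restrict_Ioi_of_levy hcorm.driving.levy
  have hh := hcorm.score_density.measurable
  have hκ : IsProbabilityMeasure (scoreLaw h) := (hcorm.law_score 0).isProbabilityMeasure_iff.1 ‹_›
  have hq : Measurable (Function.uncurry (scoreExponent (𝕏 := 𝕏) u)) :=
    measurable_scoreExponent.comp measurable_prodMk_left
  have hSe : ∀ (p : ℝ × 𝕏), p ∉ Ioi (0 : ℝ) ×ˢ (univ : Set 𝕏) → p.1 ≤ 0 := fun p hp => by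
    simpa using hp
  have key := lintegral_marked_poisson (z := fun i ω => (J i ω, x i ω)) (k := k) (κ := scoreLaw h)
    (g := fun l => scoreWeight (n l)) (q := scoreExponent u)
    -- The sum over `l` gives one constant that bounds every block; positivity of the `u j` keeps it
    -- meaningful.
    (K := ∑ l, ∏ j, ENNReal.ofReal ((n l j).factorial / u j ^ n l j))
    (fun i => (hcorm.driving.measurable_height i).prodMk (hcorm.driving.measurable_location i))
    hcorm.driving.poisson hcorm.measurable_score hcorm.law_score hcorm.iIndep_score
    hcorm.indep_driving
    (ENNReal.sum_ne_top.2 fun l _ => ENNReal.prod_ne_top fun j _ => ENNReal.ofReal_ne_top)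
    (fun l => measurable_scoreWeight _) hq (fun l => scoreWeight_ne_top _)
    (fun l p y => (scoreWeight_mul_expNeg_le (n l) hu p y).trans
      (Finset.single_le_sum (f := fun l => ∏ j, ENNReal.ofReal ((n l j).factorial / u j ^ n l j))
        (fun _ _ => zero_le) (Finset.mem_univ l)))
    (fun p h0 => by
      have hqp : Measurable (scoreExponent u p) := hq.comp measurable_prodMk_left
      rw [lintegral_eq_zero_iff hqp.expNeg] at h0
      have : ∀ᵐ y ∂scoreLaw h, False := h0.mono fun y hy =>
        expNeg_ne_zero (scoreExponent_ne_top u p y) hy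
      rw [eventually_false_iff_eq_bot, ae_eq_bot] at this
      exact IsProbabilityMeasure.ne_zero (scoreLaw h) this)
    -- Each block contains an observation, so some exponent is nonzero and the weight vanishes off
    -- `S`, where the height is nonpositive.
    (fun l p hp y => by
      have hj : ∃ j, n l j ≠ 0 := by
        by_contra! h0
        have := hn l
        simp [h0] at this
      obtain ⟨j, hj⟩ := hj
      refine Finset.prod_eq_zero (Finset.mem_univ j) ?_
      rw [ENNReal.ofReal_of_nonpos (hSe p hp), mul_zero, zero_pow hj])
    (fun p hp y => by simp [scoreExponent, ENNReal.ofReal_of_nonpos (hSe p hp)])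
  refine key.trans ?_
  have hpos : ∀ᵐ p ∂(ν.restrict (Ioi 0)).prod α, 0 < p.1 := by
    have : ∀ᵐ s ∂ν.restrict (Ioi 0), 0 < s := ae_restrict_mem measurableSet_Ioi
    exact Measure.quasiMeasurePreserving_fst.ae this
  have hsm : ∀ c n', Measurable fun s => scoreMoment f c s n' := fun c n' => by
    unfold scoreMoment
    have := hf.measurable
    refine Measurable.lintegral_prod_right' (f := fun p : ℝ × ℝ => ENNReal.ofReal
      (Real.exp (-(c * p.2 * p.1)) * (p.2 * p.1) ^ n') * (f p.2 : ℝ≥0∞)) ?_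
    fun_prop
  have hlm : Measurable fun s : ℝ => 1 - ∏ j, ∫⁻ m in Ioi 0,
      ENNReal.ofReal (Real.exp (-(u j * m * s))) * (f m : ℝ≥0∞) := by
    refine measurable_const.sub (Finset.measurable_prod _ fun j _ => ?_)
    simpa [scoreMoment] using hsm (u j) 0
  rw [mul_comm]
  congr 1
  · congr 1
    rw [laplaceExponent, ← lintegral_prod_fst hlm]
    refine lintegral_congr_ae (hpos.mono fun p hp => ?_)
    simp only
    rw [lintegral_expNeg_scoreExponent hh hf.measurable hfac hu hp]
  · have : ∀ l, ∫⁻ p, ∫⁻ y, scoreWeight (n l) p y * expNeg (scoreExponent u p y) ∂scoreLaw h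
        ∂(ν.restrict (Ioi 0)).prod α =
        α univ * ∫⁻ s in Ioi 0, ∏ j, scoreMoment f (u j) s (n l j) ∂ν := by
      intro l
      rw [← lintegral_prod_fst (Finset.measurable_prod _ fun j _ => hsm _ _)]
      exact lintegral_congr_ae (hpos.mono fun p hp =>
        lintegral_scoreWeight hh hf.measurable hfac (n l) hu hp)
    refine (Finset.prod_congr rfl fun l _ => this l).trans ?_
    simp [Finset.prod_mul_distrib]

end Main

/-! ### Removing the normalization. -/

variable {Ω 𝕏 : Type*} {d : ℕ} {J : ℕ → Ω → ℝ} {m : ℕ → Ω → Fin d → ℝ}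

/-- The mass of the `i`-th atom of the `j`-th normalized compound random measure. -/
def normalizedWeight (J : ℕ → Ω → ℝ) (m : ℕ → Ω → Fin d → ℝ) (i : ℕ) (j : Fin d) (ω : Ω) : ℝ≥0∞ :=
  (∑' i, ENNReal.ofReal (m i ω j * J i ω))⁻¹ * ENNReal.ofReal (m i ω j * J i ω)

theorem normalizedWeight_eq_zero {i : ℕ} {ω : Ω} (h : J i ω = 0) (j : Fin d) :
    normalizedWeight J m i j ω = 0 := by
  simp [normalizedWeight, h]

/-- Whatever `e` is, the total mass of group `j` occurs to the power `-∑ l, n l j = -N j`, so it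
factors out of the sum and becomes a Gamma integral. The locations `y` are arbitrary because weights
and exponents depend on heights and scores only. -/
theorem prod_normalizedWeight_eq_lintegral {k : ℕ} {n : Fin k → Fin d → ℕ} {N : Fin d → ℕ}
    (hN : ∀ j, N j = ∑ l, n l j) (hNpos : ∀ j, 1 ≤ N j) {ω : Ω} (hJ : ∀ i, 0 ≤ J i ω)
    (hT : ∀ j, ∑' i, ENNReal.ofReal (m i ω j * J i ω) ≠ 0 ∧
      ∑' i, ENNReal.ofReal (m i ω j * J i ω) ≠ ∞)
    (y : ℕ → 𝕏) :
    ∑' e : Fin k ↪ ℕ, ∏ l, ∏ j, normalizedWeight J m (e l) j ω ^ n l j =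
      ∫⁻ u in orthant d, (∏ j, ENNReal.ofReal (u j ^ ((N j : ℝ) - 1) / Real.Gamma (N j))) *
        ((∑' e : Fin k ↪ ℕ, ∏ l, scoreWeight (n l) (J (e l) ω, y (e l)) (m (e l) ω)) *
        expNeg (∑' i, scoreExponent u (J i ω, y i) (m i ω))) := by
  set T : Fin d → ℝ≥0∞ := fun j => ∑' i, ENNReal.ofReal (m i ω j * J i ω) with hTdef
  set Z := ∑' e : Fin k ↪ ℕ, ∏ l, scoreWeight (n l) (J (e l) ω, y (e l)) (m (e l) ω) with hZ
  have hmul : ∀ i j, ENNReal.ofReal (m i ω j * J i ω) =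
      ENNReal.ofReal (m i ω j) * ENNReal.ofReal (J i ω) := fun i j => ENNReal.ofReal_mul' (hJ i)
  have hexp : ∀ u : Fin d → ℝ, ∑' i, scoreExponent u (J i ω, y i) (m i ω) =
      ∑ j, ENNReal.ofReal (u j) * T j := by
    intro u
    simp only [scoreExponent, hTdef, hmul, ← ENNReal.tsum_mul_left]
    exact Summable.tsum_finsetSum fun _ _ => ENNReal.summable
  have hlhs : ∑' e : Fin k ↪ ℕ, ∏ l, ∏ j, normalizedWeight J m (e l) j ω ^ n l j =
      Z * ∏ j, (T j)⁻¹ ^ N j := by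
    rw [hZ, ← ENNReal.tsum_mul_right]
    refine tsum_congr fun e => ?_
    simp only [normalizedWeight, mul_pow, Finset.prod_mul_distrib, scoreWeight, hmul]
    rw [mul_comm]
    congr 1
    rw [Finset.prod_comm]
    refine Finset.prod_congr rfl fun j _ => ?_
    rw [Finset.prod_pow_eq_pow_sum, hN]
    simp only [hTdef, hmul]
  have hc : ∀ u : Fin d → ℝ, (∏ j, ENNReal.ofReal (u j ^ ((N j : ℝ) - 1) / Real.Gamma (N j))) *
        (Z * expNeg (∑' i, scoreExponent u (J i ω, y i) (m i ω))) =
      Z * ∏ j, ENNReal.ofReal (u j ^ ((N j : ℝ) - 1) / Real.Gamma (N j)) *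
        expNeg (ENNReal.ofReal (u j) * T j) := by
    intro u
    rw [hexp, expNeg_sum, Finset.prod_mul_distrib]
    ring
  have hFm : ∀ j, Measurable fun t : ℝ => ENNReal.ofReal (t ^ ((N j : ℝ) - 1) / Real.Gamma (N j)) *
        expNeg (ENNReal.ofReal t * T j) := fun j => by fun_prop
  have hFp : Measurable fun u : Fin d → ℝ =>
      ∏ j, ENNReal.ofReal (u j ^ ((N j : ℝ) - 1) / Real.Gamma (N j)) *
        expNeg (ENNReal.ofReal (u j) * T j) :=
    Finset.measurable_prod _ fun j _ => (hFm j).comp (measurable_pi_apply j)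
  simp_rw [hc]
  rw [hlhs, lintegral_const_mul _ hFp, lintegral_orthant_prod hFm]
  congr 1
  exact Finset.prod_congr rfl fun j _ =>
    (lintegral_gamma_expNeg (hT j).1 (hT j).2 (hNpos j)).symm

variable [MeasurableSpace 𝕏] {x : ℕ → Ω → 𝕏}

theorem corm_apply {A : Set 𝕏} (hA : MeasurableSet A) (j : Fin d) (ω : Ω) :
    corm J x m j ω A =
      ∑' i, ENNReal.ofReal (m i ω j * J i ω) * A.indicator (1 : 𝕏 → ℝ≥0∞) (x i ω) := by
  rw [corm, Measure.sum_apply _ hA]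
  refine tsum_congr fun i => ?_
  rw [Measure.smul_apply, Measure.dirac_apply' _ hA, smul_eq_mul]

theorem normalizedCorm_apply {A : Set 𝕏} (hA : MeasurableSet A) (j : Fin d) (ω : Ω) :
    normalizedCorm J x m j ω A =
      ∑' i, normalizedWeight J m i j ω * A.indicator (1 : 𝕏 → ℝ≥0∞) (x i ω) := by
  rw [normalizedCorm, Measure.smul_apply, smul_eq_mul, corm_apply hA, corm_apply MeasurableSet.univ,
    ← ENNReal.tsum_mul_left]
  simp [normalizedWeight, mul_assoc]

variable [MeasurableSpace Ω]

theorem measurable_normalizedWeight (hJ : ∀ i, Measurable (J i)) (hm : ∀ i, Measurable (m i))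
    (i : ℕ) (j : Fin d) : Measurable (normalizedWeight J m i j) := by
  have h : ∀ i, Measurable fun ω => ENNReal.ofReal (m i ω j * J i ω) := fun i =>
    (((measurable_pi_apply j).comp (hm i)).mul (hJ i)).ennreal_ofReal
  exact (Measurable.tsum h).inv.mul (h i)

/-- The total masses are positive and finite as soon as the normalized measures direct a sample. -/
theorem ae_totalMass_ne (hJ : ∀ i, Measurable (J i)) (hm : ∀ i, Measurable (m i)) {P : Measure Ω}
    [IsProbabilityMeasure P] {X : Fin d → ℕ → Ω → 𝕏}
    (hX : IsPartiallyExchangeableSample P (normalizedCorm J x m) X) :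
    ∀ᵐ ω ∂P, ∀ j, ∑' i, ENNReal.ofReal (m i ω j * J i ω) ≠ 0 ∧
      ∑' i, ENNReal.ofReal (m i ω j * J i ω) ≠ ∞ := by
  refine ae_all_iff.2 fun j => ?_
  have h1 := hX.cond_law {(j, 0)} (fun _ => univ) (fun _ => MeasurableSet.univ) univ
    MeasurableSet.univ
  simp only [preimage_univ, iInter_univ, inter_univ, measure_univ, Finset.prod_singleton,
    Measure.restrict_univ] at h1
  have hp : ∀ ω, normalizedCorm J x m j ω univ =
      (∑' i, ENNReal.ofReal (m i ω j * J i ω))⁻¹ * ∑' i, ENNReal.ofReal (m i ω j * J i ω) := by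
    intro ω
    rw [normalizedCorm_apply MeasurableSet.univ, ← ENNReal.tsum_mul_left]
    simp [normalizedWeight]
  have hpm : Measurable fun ω => normalizedCorm J x m j ω univ := by
    simp_rw [normalizedCorm_apply MeasurableSet.univ]
    refine Measurable.tsum fun i => (measurable_normalizedWeight hJ hm i j).mul ?_
    simp
  -- The total mass `T⁻¹ * T` never exceeds `1` and is `0` for `T = 0` and `T = ∞`. The sampling
  -- identity for a single observation gives it mean `1`, so it equals `1` almost surely.
  have h2 : ∀ᵐ ω ∂P, 1 ≤ normalizedCorm J x m j ω univ := by
    have hle : (fun ω => normalizedCorm J x m j ω univ) ≤ᵐ[P] fun _ => 1 :=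
      ae_of_all _ fun ω => by
        simp only [hp]
        exact ENNReal.inv_mul_le_one _
    exact (ae_eq_of_ae_le_of_lintegral_le hle (by simp [← h1]) aemeasurable_const
      (by simp [← h1])).mono fun ω hω => hω.ge
  filter_upwards [h2] with ω hω
  rw [hp] at hω
  constructor <;> intro h0 <;> simp [h0] at hω

variable {P : Measure Ω} {ν : Measure ℝ} {α : Measure 𝕏} {h : (Fin d → ℝ) → ℝ≥0} {f : ℝ → ℝ≥0}

theorem measurable_tsum_scoreWeight (hcorm : IsCoRM P ν α h J x m) {k : ℕ}
    (n : Fin k → Fin d → ℕ) : Measurable fun ω => ∑' e : Fin k ↪ ℕ,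
      ∏ l, scoreWeight (n l) (J (e l) ω, x (e l) ω) (m (e l) ω) := by
  have hz : ∀ i, Measurable fun ω => ((J i ω, x i ω), m i ω) := fun i =>
    ((hcorm.driving.measurable_height i).prodMk (hcorm.driving.measurable_location i)).prodMk
      (hcorm.measurable_score i)
  exact Measurable.tsum fun e => Finset.measurable_prod _ fun l _ =>
    (measurable_scoreWeight (n l)).comp (hz (e l))

theorem measurable_tsum_scoreExponent (hcorm : IsCoRM P ν α h J x m) :
    Measurable fun p : Ω × (Fin d → ℝ) =>
      ∑' i, scoreExponent p.2 (J i p.1, x i p.1) (m i p.1) := by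
  refine Measurable.tsum fun i => ?_
  have hz : Measurable fun p : Ω × (Fin d → ℝ) => (p.2, (J i p.1, x i p.1), m i p.1) :=
    measurable_snd.prodMk ((((hcorm.driving.measurable_height i).comp measurable_fst).prodMk
      ((hcorm.driving.measurable_location i).comp measurable_fst)).prodMk
      ((hcorm.measurable_score i).comp measurable_fst))
  exact measurable_scoreExponent.comp hz

/-- The mixed moments of the masses of the normalized compound random measures. -/
theorem lintegral_prod_normalizedWeight [IsProbabilityMeasure P] [IsFiniteMeasure α]
    (hf : IsDensity f) (hcorm : IsCoRM P ν α h J x m)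
    (hfac : Factorizes h f) {k : ℕ} {n : Fin k → Fin d → ℕ} {N : Fin d → ℕ}
    (hN : ∀ j, N j = ∑ l, n l j) (hNpos : ∀ j, 1 ≤ N j) (hn : ∀ l, 1 ≤ ∑ j, n l j)
    (hT : ∀ᵐ ω ∂P, ∀ j, ∑' i, ENNReal.ofReal (m i ω j * J i ω) ≠ 0 ∧
      ∑' i, ENNReal.ofReal (m i ω j * J i ω) ≠ ∞) :
    ∫⁻ ω, ∑' e : Fin k ↪ ℕ, ∏ l, ∏ j, normalizedWeight J m (e l) j ω ^ n l j ∂P =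
      ∫⁻ u in orthant d, (∏ j, ENNReal.ofReal (u j ^ ((N j : ℝ) - 1) / Real.Gamma (N j))) *
        expNeg (α univ * laplaceExponent ν f u) *
        (α univ ^ k * ∏ l, ∫⁻ s in Ioi 0, ∏ j, scoreMoment f (u j) s (n l j) ∂ν) := by
  have hJ0 := ae_all_iff.2 hcorm.driving.height_nonneg
  have hW := measurable_tsum_scoreWeight hcorm (k := k) n
  have hE := measurable_tsum_scoreExponent hcorm
  have hC : Measurable fun u : Fin d → ℝ =>
      ∏ j, ENNReal.ofReal (u j ^ ((N j : ℝ) - 1) / Real.Gamma (N j)) :=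
    Finset.measurable_prod _ fun j _ => by fun_prop
  have h1 : ∀ᵐ ω ∂P, ∑' e : Fin k ↪ ℕ, ∏ l, ∏ j, normalizedWeight J m (e l) j ω ^ n l j =
      ∫⁻ u in orthant d, (∏ j, ENNReal.ofReal (u j ^ ((N j : ℝ) - 1) / Real.Gamma (N j))) *
        ((∑' e : Fin k ↪ ℕ, ∏ l, scoreWeight (n l) (J (e l) ω, x (e l) ω) (m (e l) ω)) *
        expNeg (∑' i, scoreExponent u (J i ω, x i ω) (m i ω))) := by
    filter_upwards [hJ0, hT] with ω h0 hTω
    exact prod_normalizedWeight_eq_lintegral hN hNpos h0 hTω fun i => x i ω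
  have hF : Measurable (Function.uncurry fun (ω : Ω) (u : Fin d → ℝ) =>
      (∏ j, ENNReal.ofReal (u j ^ ((N j : ℝ) - 1) / Real.Gamma (N j))) *
        ((∑' e : Fin k ↪ ℕ, ∏ l, scoreWeight (n l) (J (e l) ω, x (e l) ω) (m (e l) ω)) *
        expNeg (∑' i, scoreExponent u (J i ω, x i ω) (m i ω)))) :=
    (hC.comp measurable_snd).mul ((hW.comp measurable_fst).mul hE.expNeg)
  refine (lintegral_congr_ae h1).trans ((lintegral_lintegral_swap hF.aemeasurable).trans ?_)
  refine setLIntegral_congr_fun (measurableSet_orthant d) fun u hu => ?_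
  have hEu : Measurable fun ω => ∑' i, scoreExponent u (J i ω, x i ω) (m i ω) :=
    hE.comp (measurable_prodMk_right (y := u))
  have hWE : Measurable fun ω => (∑' e : Fin k ↪ ℕ,
      ∏ l, scoreWeight (n l) (J (e l) ω, x (e l) ω) (m (e l) ω)) *
        expNeg (∑' i, scoreExponent u (J i ω, x i ω) (m i ω)) := hW.mul hEu.expNeg
  refine (lintegral_const_mul _ hWE).trans ?_
  rw [lintegral_laplace_moments hf hcorm hfac hn hu]
  exact (mul_assoc _ _ _).symm

/-! ### From points and tie patterns to distinct atoms. -/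

/-- A sum over distinct points of a product of atom masses is a sum over distinct atoms. -/
theorem tsum_embedding_prod_atoms {𝕏 : Type*} {d k : ℕ} {w : ℕ → Fin d → ℝ≥0∞} {y : ℕ → 𝕏}
    {I : Set ℕ} (hy : InjOn y I) (hw : ∀ i ∉ I, ∀ j, w i j = 0) {n : Fin k → Fin d → ℕ}
    (hn : ∀ l, ∃ j, n l j ≠ 0) {p : Fin d → 𝕏 → ℝ≥0∞}
    (hp : ∀ j a, p j a = ∑' i, w i j * ({a} : Set 𝕏).indicator (1 : 𝕏 → ℝ≥0∞) (y i)) :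
    ∑' a : Fin k ↪ 𝕏, ∏ j, ∏ l, p j (a l) ^ n l j =
      ∑' e : Fin k ↪ ℕ, ∏ l, ∏ j, w (e l) j ^ n l j := by
  have hpI : ∀ i ∈ I, ∀ j, p j (y i) = w i j := by
    intro i hi j
    rw [hp, tsum_eq_single i]
    · simp
    · intro i' hi'
      by_cases h : i' ∈ I
      · have : y i' ≠ y i := fun h' => hi' (hy h hi h')
        simp [this]
      · simp [hw i' h]
  have hp0 : ∀ a, a ∉ y '' I → ∀ j, p j a = 0 := by
    intro a ha j
    rw [hp, ENNReal.tsum_eq_zero]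
    intro i
    by_cases h : i ∈ I
    · have : y i ≠ a := fun h' => ha ⟨i, h, h'⟩
      simp [this]
    · simp [hw i h]
  let φ : (Fin k ↪ I) → (Fin k ↪ 𝕏) := fun e => e.trans ⟨fun i => y i, hy.injective⟩
  let ψ : (Fin k ↪ I) → (Fin k ↪ ℕ) := fun e => e.trans (Function.Embedding.subtype _)
  have hφ : Function.Injective φ := fun e e' h => by
    ext l
    have := DFunLike.congr_fun h l
    exact congrArg Subtype.val (hy.injective this)
  have hψ : Function.Injective ψ := fun e e' h => by
    ext l
    exact DFunLike.congr_fun h l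
  -- Both sums are supported on the embeddings into `I`: every `l` has a positive exponent, so an
  -- index outside `I` or a point outside `y '' I` makes the product vanish.
  rw [← hφ.tsum_eq, ← hψ.tsum_eq]
  · refine tsum_congr fun e => ?_
    rw [Finset.prod_comm]
    refine Finset.prod_congr rfl fun l _ => Finset.prod_congr rfl fun j _ => ?_
    exact congrArg (· ^ n l j) (hpI _ (e l).2 j)
  · intro e he
    have hmem : ∀ l, e l ∈ I := by
      intro l
      by_contra h
      obtain ⟨j, hj⟩ := hn l
      refine he (Finset.prod_eq_zero (Finset.mem_univ l)
        (Finset.prod_eq_zero (Finset.mem_univ j) ?_))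
      rw [hw _ h, zero_pow hj]
    exact ⟨⟨fun l => ⟨e l, hmem l⟩, fun l l' h => e.injective (congrArg Subtype.val h)⟩, rfl⟩
  · intro a ha
    have hmem : ∀ l, a l ∈ y '' I := by
      intro l
      by_contra h
      obtain ⟨j, hj⟩ := hn l
      refine ha (Finset.prod_eq_zero (Finset.mem_univ j)
        (Finset.prod_eq_zero (Finset.mem_univ l) ?_))
      rw [hp0 _ h, zero_pow hj]
    choose i hi hia using hmem
    refine ⟨⟨fun l => ⟨i l, hi l⟩, fun l l' h => a.injective ?_⟩, ?_⟩
    · rw [← hia l, ← hia l']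
      exact congrArg (fun t : I => y t) h
    · ext l
      exact hia l

/-- The probability that the ties among independent draws from discrete measures induce a given
partition, as a sum over distinct atoms. -/
theorem tsum_prod_indicator_partition {𝕏 : Type*} {d k : ℕ} {w : ℕ → Fin d → ℝ≥0∞} {y : ℕ → 𝕏}
    {I : Set ℕ} (hy : InjOn y I) (hw : ∀ i ∉ I, ∀ j, w i j = 0) {n : Fin k → Fin d → ℕ}
    (hn : ∀ l, ∃ j, n l j ≠ 0) {N : Fin d → ℕ} (π : (Σ j : Fin d, Fin (N j)) → Fin k)
    (hπ : ∀ l j, (Finset.univ.filter fun i : Fin (N j) => π ⟨j, i⟩ = l).card = n l j) :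
    ∑' r : (Σ j : Fin d, Fin (N j)) → ℕ, (∏ a, w (r a) a.1) *
      {b : (Σ j : Fin d, Fin (N j)) → 𝕏 | ∀ a a', b a = b a' ↔ π a = π a'}.indicator
        (1 : ((Σ j : Fin d, Fin (N j)) → 𝕏) → ℝ≥0∞) (fun a => y (r a)) =
      ∑' e : Fin k ↪ ℕ, ∏ l, ∏ j, w (e l) j ^ n l j := by
  set D := {b : (Σ j : Fin d, Fin (N j)) → 𝕏 | ∀ a a', b a = b a' ↔ π a = π a'}
  have hsurj : ∀ l, ∃ a, π a = l := by
    intro l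
    obtain ⟨j, hj⟩ := hn l
    rw [← hπ l j, Finset.card_ne_zero] at hj
    obtain ⟨i, hi⟩ := hj
    exact ⟨⟨j, i⟩, (Finset.mem_filter.1 hi).2⟩
  choose σ hσ using hsurj
  let ψ : (Fin k ↪ ℕ) → ((Σ j : Fin d, Fin (N j)) → ℕ) := fun e a => e (π a)
  have hψ : Function.Injective ψ := fun e e' h => by
    ext l
    have := congrFun h (σ l)
    simpa [ψ, hσ] using this
  -- A contributing assignment `r` takes values in `I`, where `y` is injective. The tie pattern
  -- therefore forces `r` to be constant on blocks and distinct across them, so `r` is `ψ e` with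
  -- `e` read off at the block representatives `σ`.
  rw [← hψ.tsum_eq]
  · refine tsum_congr fun e => ?_
    have hprod : ∏ a, w (ψ e a) a.1 = ∏ l, ∏ j, w (e l) j ^ n l j := by
      rw [← Finset.univ_sigma_univ, Finset.prod_sigma, Finset.prod_comm]
      refine Finset.prod_congr rfl fun j _ => ?_
      simp only [← hπ, ← Finset.prod_const]
      exact (Finset.prod_fiberwise' Finset.univ (fun i : Fin (N j) => π ⟨j, i⟩)
        (fun l => w (e l) j)).symm
    rw [hprod]
    by_cases h : ∀ l, e l ∈ I
    · have : (fun a => y (ψ e a)) ∈ D := fun a a' =>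
        ⟨fun h' => e.injective (hy (h _) (h _) h'), fun h' => congrArg (fun l => y (e l)) h'⟩
      rw [indicator_of_mem this, Pi.one_apply, mul_one]
    · push Not at h
      obtain ⟨l, hl⟩ := h
      obtain ⟨j, hj⟩ := hn l
      rw [Finset.prod_eq_zero (Finset.mem_univ l), zero_mul]
      refine Finset.prod_eq_zero (Finset.mem_univ j) ?_
      rw [hw _ hl, zero_pow hj]
  · intro r hr
    have hrI : ∀ a, r a ∈ I := by
      intro a
      by_contra h
      refine hr ?_
      simp only
      rw [Finset.prod_eq_zero (Finset.mem_univ a) (hw _ h _), zero_mul]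
    have hrD : ∀ a a', y (r a) = y (r a') ↔ π a = π a' := by
      by_contra h
      refine hr ?_
      have h' : (fun a => y (r a)) ∉ D := h
      simp only [indicator_of_notMem h', mul_zero]
    refine ⟨⟨fun l => r (σ l), fun l l' h => ?_⟩, ?_⟩
    · rw [← hσ l, ← hσ l', ← hrD]
      exact congrArg y h
    · funext a
      exact hy (hrI _) (hrI _) ((hrD _ _).2 (hσ _))

/-! ### The joint law of the sample. -/

section Sample

variable {Ω 𝕏 : Type*} [MeasurableSpace Ω] [MeasurableSpace 𝕏] {P : Measure Ω}
  {d : ℕ} {J : ℕ → Ω → ℝ} {x : ℕ → Ω → 𝕏} {m : ℕ → Ω → Fin d → ℝ} {X : Fin d → ℕ → Ω → 𝕏}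

/-- The joint law of finitely many observations, as a mixture over the atoms they are drawn from. -/
theorem map_sample_eq_sum [IsProbabilityMeasure P] (hJ : ∀ i, Measurable (J i))
    (hx : ∀ i, Measurable (x i)) (hm : ∀ i, Measurable (m i))
    (hX : IsPartiallyExchangeableSample P (normalizedCorm J x m) X) (N : Fin d → ℕ) :
    P.map (fun ω (a : Σ j : Fin d, Fin (N j)) => X a.1 a.2 ω) =
      Measure.sum fun r : (Σ j : Fin d, Fin (N j)) → ℕ =>
        (P.withDensity fun ω => ∏ a, normalizedWeight J m (r a) a.1 ω).map
          fun ω a => x (r a) ω := by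
  have hXm : Measurable fun ω (a : Σ j : Fin d, Fin (N j)) => X a.1 a.2 ω :=
    measurable_pi_lambda _ fun a => hX.measurable _ _
  have hxm : ∀ r : (Σ j : Fin d, Fin (N j)) → ℕ, Measurable fun ω a => x (r a) ω :=
    fun r => measurable_pi_lambda _ fun a => hx _
  have hrect : ∀ A : (Σ j : Fin d, Fin (N j)) → Set 𝕏, (∀ a, MeasurableSet (A a)) →
      P.map (fun ω (a : Σ j : Fin d, Fin (N j)) => X a.1 a.2 ω) (univ.pi A) =
      (Measure.sum fun r : (Σ j : Fin d, Fin (N j)) → ℕ =>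
        (P.withDensity fun ω => ∏ a, normalizedWeight J m (r a) a.1 ω).map
          fun ω a => x (r a) ω) (univ.pi A) := by
    intro A hA
    have hpi : MeasurableSet (univ.pi A) := MeasurableSet.univ_pi hA
    let ι : (Σ j : Fin d, Fin (N j)) ↪ Fin d × ℕ :=
      ⟨fun a => (a.1, a.2), by
        rintro ⟨j, i⟩ ⟨j', i'⟩ h
        obtain ⟨rfl, h2⟩ := Prod.mk.inj h
        simp only [Sigma.mk.injEq, heq_eq_eq, true_and]
        exact Fin.ext h2⟩
    -- The sampling hypothesis asks for sets indexed by the whole array; `univ` is a filler outside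
    -- the sample.
    let B : Fin d × ℕ → Set 𝕏 := fun b => if h : b.2 < N b.1 then A ⟨b.1, ⟨b.2, h⟩⟩ else univ
    have hB : ∀ b, MeasurableSet (B b) := by
      intro b
      simp only [B]
      split_ifs
      · exact hA _
      · exact MeasurableSet.univ
    have hBι : ∀ a, B (ι a) = A a := fun a =>
      dif_pos a.2.2
    have hcond := hX.cond_law (Finset.univ.map ι) B hB univ MeasurableSet.univ
    rw [univ_inter, Measure.restrict_univ] at hcond
    have hset : (⋂ b ∈ Finset.univ.map ι, X b.1 b.2 ⁻¹' B b) =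
        (fun ω (a : Σ j : Fin d, Fin (N j)) => X a.1 a.2 ω) ⁻¹' univ.pi A := by
      ext ω
      simp only [Finset.mem_map, Finset.mem_univ, true_and, mem_iInter, mem_preimage, Set.mem_pi,
        forall_exists_index, forall_apply_eq_imp_iff, hBι]
      exact ⟨fun h a _ => h a, fun h a => h a trivial⟩
    rw [Measure.map_apply hXm hpi, ← hset, hcond, Measure.sum_apply _ hpi]
    have hr : ∀ r : (Σ j : Fin d, Fin (N j)) → ℕ,
        ((P.withDensity fun ω => ∏ a, normalizedWeight J m (r a) a.1 ω).map
          fun ω a => x (r a) ω) (univ.pi A) =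
        ∫⁻ ω, ∏ a, normalizedWeight J m (r a) a.1 ω *
          (A a).indicator (1 : 𝕏 → ℝ≥0∞) (x (r a) ω) ∂P := by
      intro r
      rw [Measure.map_apply (hxm r) hpi, withDensity_apply _ (hxm r hpi),
        ← lintegral_indicator (hxm r hpi)]
      refine lintegral_congr fun ω => ?_
      by_cases h : ∀ a, x (r a) ω ∈ A a
      · rw [indicator_of_mem (by simpa using h)]
        simp [h]
      · rw [indicator_of_notMem (by simpa using h)]
        push Not at h
        obtain ⟨a, ha⟩ := h
        rw [Finset.prod_eq_zero (Finset.mem_univ a)]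
        simp [ha]
    simp_rw [hr]
    rw [← lintegral_tsum fun r => Measurable.aemeasurable <| Finset.measurable_prod _ fun a _ =>
      (measurable_normalizedWeight hJ hm (r a) a.1).mul
        ((measurable_one.indicator (hA a)).comp (hx (r a)))]
    refine lintegral_congr fun ω => ?_
    -- Distributing the product of the sums `p_j(A)` over atoms yields one term for each assignment
    -- `r` of atoms to observations.
    rw [Finset.prod_map, ← prod_tsum_eq_tsum_prod (fun a i => normalizedWeight J m i a.1 ω *
          (A a).indicator (1 : 𝕏 → ℝ≥0∞) (x i ω))]
    refine Finset.prod_congr rfl fun a _ => ?_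
    rw [hBι, normalizedCorm_apply (hA a)]
    rfl
  have : IsFiniteMeasure (P.map fun ω (a : Σ j : Fin d, Fin (N j)) => X a.1 a.2 ω) :=
    inferInstance
  refine ext_of_generate_finite _ generateFrom_pi.symm isPiSystem_pi ?_ ?_
  · rintro _ ⟨A, hA, rfl⟩
    exact hrect A fun a => hA a (mem_univ a)
  · simpa using hrect (fun _ => univ) fun _ => MeasurableSet.univ

/-- The tie pattern is not a rectangle, so the product formula of the model does not apply to it
directly; the mixture form of the full joint law does, since the diagonals are measurable. -/
theorem measure_partitionEvent [MeasurableEq 𝕏] [IsProbabilityMeasure P]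
    (hJ : ∀ i, Measurable (J i)) (hx : ∀ i, Measurable (x i)) (hm : ∀ i, Measurable (m i))
    (hX : IsPartiallyExchangeableSample P (normalizedCorm J x m) X) {N : Fin d → ℕ} {k : ℕ}
    (π : (Σ j : Fin d, Fin (N j)) → Fin k) :
    P (partitionEvent X N π) =
      ∫⁻ ω, ∑' r : (Σ j : Fin d, Fin (N j)) → ℕ, (∏ a, normalizedWeight J m (r a) a.1 ω) *
        {b : (Σ j : Fin d, Fin (N j)) → 𝕏 | ∀ a a', b a = b a' ↔ π a = π a'}.indicator
          (1 : ((Σ j : Fin d, Fin (N j)) → 𝕏) → ℝ≥0∞) (fun a => x (r a) ω) ∂P := by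
  have hXm : Measurable fun ω (a : Σ j : Fin d, Fin (N j)) => X a.1 a.2 ω :=
    measurable_pi_lambda _ fun a => hX.measurable _ _
  have hxm : ∀ r : (Σ j : Fin d, Fin (N j)) → ℕ, Measurable fun ω a => x (r a) ω :=
    fun r => measurable_pi_lambda _ fun a => hx _
  have hD : MeasurableSet
      {b : (Σ j : Fin d, Fin (N j)) → 𝕏 | ∀ a a', b a = b a' ↔ π a = π a'} := by
    simp only [Set.ofPred_forall]
    refine MeasurableSet.iInter fun a => MeasurableSet.iInter fun a' => ?_
    have h : MeasurableSet {b : (Σ j : Fin d, Fin (N j)) → 𝕏 | b a = b a'} :=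
      measurableSet_eq_fun (measurable_pi_apply a) (measurable_pi_apply a')
    by_cases hπ : π a = π a'
    · simp only [hπ, iff_true]
      exact h
    · simp only [hπ, iff_false]
      exact h.compl
  have hw : ∀ r : (Σ j : Fin d, Fin (N j)) → ℕ,
      Measurable fun ω => ∏ a, normalizedWeight J m (r a) a.1 ω := fun r =>
    Finset.measurable_prod _ fun a _ => measurable_normalizedWeight hJ hm (r a) a.1
  have h1 : P (partitionEvent X N π) =
      P.map (fun ω (a : Σ j : Fin d, Fin (N j)) => X a.1 a.2 ω)
        {b | ∀ a a', b a = b a' ↔ π a = π a'} := by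
    rw [Measure.map_apply hXm hD]
    rfl
  rw [h1, map_sample_eq_sum hJ hx hm hX, Measure.sum_apply _ hD]
  refine Eq.trans (tsum_congr fun r => ?_) (lintegral_tsum fun r =>
    ((hw r).mul ((measurable_one.indicator hD).comp (hxm r))).aemeasurable).symm
  rw [Measure.map_apply (hxm r) hD, withDensity_apply _ (hxm r hD),
    ← lintegral_indicator (hxm r hD)]
  refine lintegral_congr fun ω => ?_
  rw [Pi.mul_apply, Function.comp_apply]
  by_cases h : (fun a => x (r a) ω) ∈
      {b : (Σ j : Fin d, Fin (N j)) → 𝕏 | ∀ a a', b a = b a' ↔ π a = π a'}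
  · rw [indicator_of_mem h, indicator_of_mem (by exact h), Pi.one_apply, mul_one]
  · rw [indicator_of_notMem h, indicator_of_notMem (by exact h), mul_zero]

end Sample

end CoRM

end

/-! ### The formula for the pEPPF and the partition probabilities. -/

theorem proposition1
    {Ω 𝕏 : Type*} [MeasurableSpace Ω] (P : Measure Ω) [IsProbabilityMeasure P]
    [TopologicalSpace 𝕏] [PolishSpace 𝕏] [MeasurableSpace 𝕏] [BorelSpace 𝕏]
    (d : ℕ)
    -- directing Lévy measure, finite diffuse base measure, score densities
    (ν : Measure ℝ) (α : Measure 𝕏) [IsFiniteMeasure α] [NullSingletonClass α] (hα : α ≠ 0)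
    (h : (Fin d → ℝ) → ℝ≥0) (f : ℝ → ℝ≥0) (hf : CoRM.IsDensity f)
    -- the vector of compound random measures
    (J : ℕ → Ω → ℝ) (x : ℕ → Ω → 𝕏) (m : ℕ → Ω → Fin d → ℝ)
    (hcorm : CoRM.IsCoRM P ν α h J x m)
    (hA1 : CoRM.RegularityCondition ν h)
    (hA2 : CoRM.Factorizes h f)
    (hA3 : CoRM.InfiniteActivity ν f)
    -- a partially exchangeable array directed by the normalized vector
    (X : Fin d → ℕ → Ω → 𝕏)
    (hX : CoRM.IsPartiallyExchangeableSample P (CoRM.normalizedCorm J x m) X)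
    -- frequencies `n ℓ j` and sample sizes `N j`
    (k : ℕ) (n : Fin k → Fin d → ℕ) (N : Fin d → ℕ)
    (hN : ∀ j, N j = ∑ ℓ, n ℓ j) (hNpos : ∀ j, 1 ≤ N j) (hn : ∀ ℓ, 1 ≤ ∑ j, n ℓ j) :
    let R : ℝ≥0∞ :=
      ∫⁻ u in CoRM.orthant d,
        (∏ j, ENNReal.ofReal (u j ^ ((N j : ℝ) - 1) / Real.Gamma (N j))) *
        EReal.exp (-((α univ * CoRM.laplaceExponent ν f u : ℝ≥0∞) : EReal)) *
        (α univ ^ k * ∏ ℓ, ∫⁻ s in Ioi 0, ∏ j, CoRM.scoreMoment f (u j) s (n ℓ j) ∂ν)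
    CoRM.pEPPF P (CoRM.normalizedCorm J x m) n = R ∧
    ∀ π : (Σ j : Fin d, Fin (N j)) → Fin k,
      (∀ ℓ j, (Finset.univ.filter fun i : Fin (N j) => π ⟨j, i⟩ = ℓ).card = n ℓ j) →
      P (CoRM.partitionEvent X N π) = R := by
  intro R
  have hJ := hcorm.driving.measurable_height
  have hx := hcorm.driving.measurable_location
  have hm := hcorm.measurable_score
  have hσ := sigmaFinite_restrict_Ioi_of_levy hcorm.driving.levy
  have hn' : ∀ l, ∃ j, n l j ≠ 0 := by
    intro l
    by_contra! h0
    have := hn l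
    simp [h0] at this
  have hQ := CoRM.lintegral_prod_normalizedWeight hf hcorm hA2 hN hNpos hn
    (CoRM.ae_totalMass_ne hJ hm hX)
  have hS : MeasurableSet (Ioi (0 : ℝ) ×ˢ (univ : Set 𝕏)) := measurableSet_Ioi.prod MeasurableSet.univ
  -- This is the input of both atom lemmas with `I` the set of indices of positive height; terms of
  -- height zero may repeat locations but carry no mass.
  have hdist : ∀ᵐ ω ∂P, InjOn (fun i => x i ω) {i | 0 < J i ω} ∧
      ∀ i ∉ {i | 0 < J i ω}, ∀ j, CoRM.normalizedWeight J m i j ω = 0 := by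
    filter_upwards [ae_snd_injOn_of_poisson hS (fun i => (hJ i).prodMk (hx i))
      hcorm.driving.poisson, ae_all_iff.2 hcorm.driving.height_nonneg] with ω hω h0
    refine ⟨fun i hi j hj hij => hω i j ⟨hi, trivial⟩ ⟨hj, trivial⟩ hij, fun i hi j => ?_⟩
    exact CoRM.normalizedWeight_eq_zero (le_antisymm (not_lt.1 hi) (h0 i)) j
  refine ⟨Eq.trans (lintegral_congr_ae ?_) hQ, fun π hπ => ?_⟩
  · filter_upwards [hdist] with ω hω
    exact CoRM.tsum_embedding_prod_atoms hω.1 hω.2 hn'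
      (p := fun j a => CoRM.normalizedCorm J x m j ω {a})
      fun j a => CoRM.normalizedCorm_apply (measurableSet_singleton a) j ω
  · rw [CoRM.measure_partitionEvent hJ hx hm hX π]
    refine Eq.trans (lintegral_congr_ae ?_) hQ
    filter_upwards [hdist] with ω hω
    exact CoRM.tsum_prod_indicator_partition (w := fun i j => CoRM.normalizedWeight J m i j ω)
      (y := fun i => x i ω) hω.1 hω.2 hn' π hπ
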